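/- Let $G\subset\mathbb{C}^n$ be a bounded domain (nonempty, open, connected) which is $n$-circled (i.e. $(e^{i\theta_1}z_1,\dots,e^{i\theta_n}z_n)\in G$ for all $z\in G$ and $\theta\in\mathbb{R}^n$), fat (i.e. $G=\operatorname{int}\overline{G}$), and a domain of holomorphy. For $f$ holomorphic on $G$ and $\nu\in\mathbb{Z}_+^n$ write $\partial^\nu f=\partial^{|\nu|}f/\partial z_1^{\nu_1}\cdots\partial z_n^{\nu_n}$. For $k\in\mathbb{Z}_+$ let $\mathcal{A}^k(G)$ be the set of all $f\in\mathcal{O}(G)$ such that for every $\nu$ with $|\nu|\le k$ the derivative $\partial^\nu f$ extends to a continuous function on $\overline{G}$, and let $\mathcal{A}^\infty(G)=\bigcap_{k}\mathcal{A}^k(G)$. For a family $\mathcal{F}\subset\mathcal{O}(G)$, the domain $G$ is called an $\mathcal{F}$-domain of holomorphy if there are no domains $G_0,\widetilde G\subset\mathbb{C}^n$ with $\varnothing\ne G_0\subset G\cap\widetilde G$ and $\widetilde G\not\subset G$ such that for every $f\in\mathcal{F}$ there is $\widetilde f\in\mathcal{O}(\widetilde G)$ with $\widetilde f=f$ on $G_0$;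 a domain of holomorphy is an $\mathcal{O}(G)$-domain of holomorphy. For $\varepsilon\in\{0,1\}^n$ put $$V_\varepsilon=\{z\in\mathbb{C}^n : z_j=0 \text{ if } \varepsilon_j=1,\ z_j\neq 0 \text{ if } \varepsilon_j=0\},$$ $$G_\varepsilon=\{(\lambda_1^{\varepsilon_1}z_1,\dots,\lambda_n^{\varepsilon_n}z_n) : \lambda_j\in\mathbb{C},\ |\lambda_j|\le 1,\ z\in G\},$$ where $\lambda^0=1$ for every $\lambda$. Then $G$ is an $\mathcal{A}^\infty(G)$-domain of holomorphy if and only if for every $\varepsilon\in\{0,1\}^n$ with $V_\varepsilon\cap\partial G\neq\varnothing$ one has $G_\varepsilon\subset G$. -/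

import Mathlib

namespace NCircled

/-- A domain in `ℂⁿ`: a nonempty connected open set. -/
def IsComplexDomain {n : ℕ} (G : Set (Fin n → ℂ)) : Prop :=
  IsOpen G ∧ IsConnected G

/-- `G` is invariant under all rotations `z ↦ (e^{iθ₁} z₁, …, e^{iθₙ} zₙ)`. -/
def IsCircled {n : ℕ} (G : Set (Fin n → ℂ)) : Prop :=
  ∀ z ∈ G, ∀ θ : Fin n → ℝ, (fun j => Complex.exp ((θ j : ℂ) * Complex.I) * z j) ∈ G

/-- `G` is fat: it equals the interior of its closure. -/
def IsFat {n : ℕ} (G : Set (Fin n → ℂ)) : Prop :=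
  G = interior (closure G)

/-- The space `𝒪(G)`. Functions on `G` are represented by functions on `ℂⁿ`; for open `G` this
condition, and all those below, depend only on the values on `G`. -/
def holomorphicOn {n : ℕ} (G : Set (Fin n → ℂ)) : Set ((Fin n → ℂ) → ℂ) :=
  {f | DifferentiableOn ℂ f G}

/-- The complex partial derivative `∂f/∂z_j`. -/
noncomputable def partialDeriv {n : ℕ} (j : Fin n) (f : (Fin n → ℂ) → ℂ) : (Fin n → ℂ) → ℂ :=
  fun z => fderiv ℂ f z (Pi.single j 1)

/-- The derivative `∂^ν f = ∂^{|ν|} f / ∂z₁^{ν₁} ⋯ ∂zₙ^{νₙ}`. -/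
noncomputable def multiDeriv {n : ℕ} (ν : Fin n → ℕ) (f : (Fin n → ℂ) → ℂ) :
    (Fin n → ℂ) → ℂ :=
  (List.finRange n).foldr (fun j g => (partialDeriv j)^[ν j] g) f

/-- The space `𝒜^k(G)`: holomorphic functions on `G` all of whose derivatives of order at most `k`
extend continuously to the closure of `G`. -/
def spaceA {n : ℕ} (k : ℕ) (G : Set (Fin n → ℂ)) : Set ((Fin n → ℂ) → ℂ) :=
  {f | f ∈ holomorphicOn G ∧ ∀ ν : Fin n → ℕ, ∑ j, ν j ≤ k →
    ∃ g : (Fin n → ℂ) → ℂ, ContinuousOn g (closure G) ∧ Set.EqOn g (multiDeriv ν f) G}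

/-- The space `𝒜^∞(G)`. -/
def spaceAInfty {n : ℕ} (G : Set (Fin n → ℂ)) : Set ((Fin n → ℂ) → ℂ) :=
  ⋂ k : ℕ, spaceA k G

/-- `G` is an `F`-domain of holomorphy, for a family `F` of holomorphic functions on the
domain `G`: there are no domains `G₀`, `G'` with `G₀ ⊆ G ∩ G'` and `G' ⊄ G` such that every `f ∈ F`
restricted to `G₀` has a holomorphic extension to `G'`. -/
def IsDomainOfHolomorphyFor {n : ℕ} (F : Set ((Fin n → ℂ) → ℂ)) (G : Set (Fin n → ℂ)) : Prop :=
  ¬ ∃ G₀ G' : Set (Fin n → ℂ), IsComplexDomain G₀ ∧ IsComplexDomain G' ∧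
    G₀ ⊆ G ∩ G' ∧ ¬ G' ⊆ G ∧
    ∀ f ∈ F, ∃ f' ∈ holomorphicOn G', Set.EqOn f' f G₀

/-- A domain of holomorphy is an `𝒪(G)`-domain of holomorphy. -/
def IsDomainOfHolomorphy {n : ℕ} (G : Set (Fin n → ℂ)) : Prop :=
  IsDomainOfHolomorphyFor (holomorphicOn G) G

/-- The stratum `V_ε`: exactly the coordinates `z_j` with `ε_j = 1` vanish. -/
def stratum {n : ℕ} (ε : Fin n → Fin 2) : Set (Fin n → ℂ) :=
  {z | (∀ j, ε j = 1 → z j = 0) ∧ (∀ j, ε j = 0 → z j ≠ 0)}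

/-- The set `G_ε = {(λ₁^{ε₁} z₁, …, λₙ^{εₙ} zₙ) : |λ_j| ≤ 1, z ∈ G}`. -/
def partialHull {n : ℕ} (ε : Fin n → Fin 2) (G : Set (Fin n → ℂ)) : Set (Fin n → ℂ) :=
  {w | ∃ l : Fin n → ℂ, (∀ j, ‖l j‖ ≤ 1) ∧ ∃ z ∈ G, w = fun j => l j ^ (ε j : ℕ) * z j}

end NCircled

/-! A holomorphic function on a circled domain has a Laurent expansion whose terms are its Fourier
coefficients along torus orbits. In logarithmic coordinates `x`, boundedness of the terms `|a_α|
exp⟨α, x⟩` is a convex condition, and on an open set it forces normal convergence. Hence, if `G` is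
an `F`-domain of holomorphy, every open convex set meeting `log G` over which all expansions from
`F` have bounded terms lies in `log G` (`subset_logSet_of_coeffBounded`). So `log G` is convex; and
if no member of `F` has negative powers of `z_j`, then `log G` is stable under lowering `x_j`, which
fatness turns into completeness of `G` in `z_j`.

Necessity: let the closure of `G` meet `{z_j = 0}`, and suppose some `f` in `𝒜^∞` has a term with
`α_j < 0`. Differentiating `α⁺` times leaves a nonzero coefficient at `min(α, 0)`. That derivative
is bounded, but the monomial blows up as `z_j → 0` because the other coordinates stay bounded. So `F
= 𝒜^∞` has no negative powers of `z_j`.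

Sufficiency: `G` is complete in every coordinate whose hyperplane meets its closure, by hypothesis
for boundary points and by the absence of negative powers for points of `G`. A point `b` outside the
closure, with nonzero coordinates, is then separated from `log G` by an integral `α` that is
nonnegative in these coordinates (`exists_integral_separation`). Thus `|z^α| < |b^α|` on the
closure, and `1/(z^α - b^α)` is holomorphic near it, hence in `𝒜^∞`, but cannot be continued to `b`.
-/

open MeasureTheory Metric Set Filter Topology

namespace NCircled

/-! ### Holomorphic functions of several variables -/

/-- Cauchy's estimate for the Fréchet derivative of a bounded holomorphic function. -/
theorem norm_fderiv_le_of_bounded {E : Type*} [NormedAddCommGroup E] [NormedSpace ℂ E]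
    {f : E → ℂ} {z : E} {ρ M : ℝ} (hρ : 0 < ρ) (hf : DifferentiableOn ℂ f (ball z ρ))
    (hM : ∀ w ∈ ball z ρ, ‖f w‖ ≤ M) : ‖fderiv ℂ f z‖ ≤ (2 * M) / ρ := by
  refine Complex.norm_fderiv_le_div_of_mapsTo_ball hf (fun w hw => ?_) hρ
  rw [mem_closedBall, dist_eq_norm]
  calc ‖f w - f z‖ ≤ ‖f w‖ + ‖f z‖ := norm_sub_le _ _
    _ ≤ 2 * M := by linarith [hM w hw, hM z (mem_ball_self hρ)]

/-- Differentiation under the integral sign for an integral of translates and contractions of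
a holomorphic function. -/
theorem hasFDerivAt_integral_comp {E : Type*} [NormedAddCommGroup E] [NormedSpace ℂ E]
    [FiniteDimensional ℂ E]
    {T : Type*} [TopologicalSpace T] [MeasurableSpace T] [BorelSpace T] [SecondCountableTopology T]
    {μ : Measure T} [IsFiniteMeasure μ] {k : T → ℂ} (hk : Continuous k) {C : ℝ}
    (hkC : ∀ t, ‖k t‖ ≤ C) {A : T → E →L[ℂ] E} (hA : Continuous A) (hA1 : ∀ t, ‖A t‖ ≤ 1)
    {b : T → E} (hb : Continuous b) {f : E → ℂ} {U : Set E} (hU : IsOpen U)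
    (hf : DifferentiableOn ℂ f U) {z₀ : E} {K : Set E} (hK : IsCompact K) (hKU : K ⊆ U)
    (hz₀ : ∀ t, A t z₀ + b t ∈ K) :
    Integrable (fun t => k t • (fderiv ℂ f (A t z₀ + b t)).comp (A t)) μ ∧
    HasFDerivAt (fun z => ∫ t, k t * f (A t z + b t) ∂μ)
      (∫ t, k t • (fderiv ℂ f (A t z₀ + b t)).comp (A t) ∂μ) z₀ := by
  have : ProperSpace E := FiniteDimensional.proper ℂ E
  borelize E
  obtain ⟨δ, hδ, hδU⟩ := hK.exists_cthickening_subset_open hU hKU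
  have hKc : IsCompact (cthickening δ K) := hK.cthickening
  obtain ⟨M, hM⟩ := hKc.exists_bound_of_continuousOn (hf.continuousOn.mono hδU)
  -- Half of `δ` absorbs the motion of `z₀` (each `A t` is a contraction); the other half is the
  -- radius for Cauchy's estimate.
  have hball : ∀ x ∈ ball z₀ (δ / 2), ∀ t, ball (A t x + b t) (δ / 2) ⊆ cthickening δ K := by
    intro x hx t w hw
    refine mem_cthickening_of_dist_le w (A t z₀ + b t) δ K (hz₀ t) ?_
    have h1 : dist (A t x + b t) (A t z₀ + b t) ≤ δ / 2 := by
      rw [dist_add_right, dist_eq_norm, ← map_sub]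
      calc ‖A t (x - z₀)‖ ≤ ‖A t‖ * ‖x - z₀‖ := (A t).le_opNorm _
        _ ≤ 1 * ‖x - z₀‖ := by gcongr; exact hA1 t
        _ ≤ δ / 2 := by rw [one_mul, ← dist_eq_norm]; exact (mem_ball.1 hx).le
    have h2 := mem_ball.1 hw
    linarith [dist_triangle w (A t x + b t) (A t z₀ + b t)]
  have hδ2 : 0 < δ / 2 := by positivity
  have hmem : ∀ x ∈ ball z₀ (δ / 2), ∀ t, A t x + b t ∈ U := fun x hx t =>
    hδU (hball x hx t (mem_ball_self hδ2))
  have hcont : ∀ x ∈ ball z₀ (δ / 2), Continuous fun t => k t * f (A t x + b t) := by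
    intro x hx
    refine hk.mul ?_
    exact hf.continuousOn.comp_continuous (by fun_prop) (hmem x hx)
  have hz₀b : z₀ ∈ ball z₀ (δ / 2) := mem_ball_self hδ2
  have hmeas : AEStronglyMeasurable
      (fun t => k t • (fderiv ℂ f (A t z₀ + b t)).comp (A t)) μ := by
    have h1 : Measurable fun t => fderiv ℂ f (A t z₀ + b t) :=
      (measurable_fderiv ℂ f).comp (by fun_prop : Continuous fun t => A t z₀ + b t).measurable
    have h2 : StronglyMeasurable fun t => (fderiv ℂ f (A t z₀ + b t), A t) :=
      (h1.stronglyMeasurable).prodMk hA.stronglyMeasurable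
    have h3 : Continuous fun p : (E →L[ℂ] ℂ) × (E →L[ℂ] E) => p.1.comp p.2 := by fun_prop
    exact (hk.stronglyMeasurable.smul (h3.comp_stronglyMeasurable h2)).aestronglyMeasurable
  have hbound : ∀ t, ∀ x ∈ ball z₀ (δ / 2),
      ‖k t • (fderiv ℂ f (A t x + b t)).comp (A t)‖ ≤ C * ((2 * M) / (δ / 2)) := by
    intro t x hx
    have hfd : ‖fderiv ℂ f (A t x + b t)‖ ≤ (2 * M) / (δ / 2) :=
      norm_fderiv_le_of_bounded hδ2 (hf.mono ((hball x hx t).trans hδU))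
        fun w hw => hM w (hball x hx t hw)
    rw [norm_smul]
    refine mul_le_mul (hkC t) ?_ (norm_nonneg _) ((norm_nonneg _).trans (hkC t))
    calc ‖(fderiv ℂ f (A t x + b t)).comp (A t)‖ ≤ ‖fderiv ℂ f (A t x + b t)‖ * ‖A t‖ :=
          ContinuousLinearMap.opNorm_comp_le _ _
      _ ≤ ‖fderiv ℂ f (A t x + b t)‖ * 1 := by gcongr; exact hA1 t
      _ ≤ _ := by rwa [mul_one]
  refine ⟨Integrable.of_bound hmeas _ (Eventually.of_forall fun t => hbound t z₀ hz₀b),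
    hasFDerivAt_integral_of_dominated_of_fderiv_le (𝕜 := ℂ)
    (F' := fun x t => k t • (fderiv ℂ f (A t x + b t)).comp (A t))
    (bound := fun _ => C * ((2 * M) / (δ / 2))) (ball_mem_nhds z₀ hδ2) ?_ ?_ hmeas
    (Eventually.of_forall hbound) (integrable_const _) ?_⟩
  · filter_upwards [ball_mem_nhds z₀ hδ2] with x hx
    exact (hcont x hx).aestronglyMeasurable
  · refine Integrable.of_bound (hcont z₀ hz₀b).aestronglyMeasurable (C * M) ?_
    refine Eventually.of_forall fun t => ?_
    rw [norm_mul]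
    have := hM _ (hball z₀ hz₀b t (mem_ball_self hδ2))
    gcongr
    · exact (norm_nonneg _).trans (hkC t)
    · exact hkC t
  · refine Eventually.of_forall fun t x hx => ?_
    have h1 : HasFDerivAt f (fderiv ℂ f (A t x + b t)) (A t x + b t) :=
      (hf.differentiableAt (hU.mem_nhds (hmem x hx t))).hasFDerivAt
    have h2 : HasFDerivAt (fun x => A t x + b t) (A t) x := (A t).hasFDerivAt.add_const _
    exact (h1.comp x h2).const_mul (k t)

variable {n : ℕ}

/-- Cauchy's formula on a small circle in the direction `e_j` writes the partial derivative as an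
integral of translates of `f`, which can be differentiated under the integral sign. -/
theorem holomorphicOn_partialDeriv {U : Set (Fin n → ℂ)} (hU : IsOpen U) (j : Fin n)
    {f : (Fin n → ℂ) → ℂ} (hf : f ∈ holomorphicOn U) : partialDeriv j f ∈ holomorphicOn U := by
  have hf : DifferentiableOn ℂ f U := hf
  intro z₀ hz₀
  refine DifferentiableAt.differentiableWithinAt ?_
  set e : Fin n → ℂ := Pi.single j 1
  have hen : ‖e‖ = 1 := by simp [e, Pi.norm_single]
  obtain ⟨r, hr, hrU⟩ := Metric.isOpen_iff.1 hU z₀ hz₀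
  have hr4 : 0 < r / 4 := by positivity
  have key : ∀ z ∈ ball z₀ (r / 4), ∀ ζ ∈ ball (0 : ℂ) (r / 2), z + ζ • e ∈ ball z₀ r := by
    intro z hz ζ hζ
    rw [mem_ball, dist_eq_norm] at *
    calc ‖z + ζ • e - z₀‖ = ‖(z - z₀) + ζ • e‖ := by congr 1; abel
      _ ≤ ‖z - z₀‖ + ‖ζ • e‖ := norm_add_le _ _
      _ = ‖z - z₀‖ + ‖ζ - 0‖ := by rw [norm_smul, hen, mul_one, sub_zero]
      _ < r := by linarith
  have hformula : ∀ z ∈ ball z₀ (r / 4), partialDeriv j f z =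
      ∫ θ in Ioc (0 : ℝ) (2 * Real.pi), ((2 * Real.pi * Complex.I : ℂ)⁻¹ *
        (deriv (circleMap 0 (r / 4)) θ * ((circleMap 0 (r / 4) θ - 0) ^ 2)⁻¹)) *
        f (z + circleMap 0 (r / 4) θ • e) := by
    intro z hz
    have hg : DifferentiableOn ℂ (fun ζ : ℂ => f (z + ζ • e)) (ball 0 (r / 2)) := by
      intro ζ hζ
      refine DifferentiableAt.differentiableWithinAt ?_
      have : DifferentiableAt ℂ f (z + ζ • e) :=
        hf.differentiableAt (hU.mem_nhds (hrU (key z hz ζ hζ)))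
      exact DifferentiableAt.comp (g := f) ζ this (by fun_prop)
    have h1 := Complex.two_pi_I_inv_smul_circleIntegral_sub_sq_inv_smul_of_differentiable
      isOpen_ball (closedBall_subset_ball (by linarith : r / 4 < r / 2)) hg
      (mem_ball_self hr4)
    have h2 : deriv (fun ζ : ℂ => f (z + ζ • e)) 0 = partialDeriv j f z := by
      have h0 : DifferentiableAt ℂ f (z + (0 : ℂ) • e) :=
        hf.differentiableAt (hU.mem_nhds (hrU (key z hz 0 (mem_ball_self (by positivity)))))
      have h3 : HasDerivAt (fun ζ : ℂ => z + ζ • e) e 0 := by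
        simpa using ((hasDerivAt_id (0 : ℂ)).smul_const e).const_add z
      have := (h0.hasFDerivAt.comp_hasDerivAt 0 h3).deriv
      simpa [partialDeriv, e, Function.comp_def] using this
    rw [← h2, ← h1, circleIntegral, intervalIntegral.integral_of_le (by positivity),
      ← integral_smul]
    refine integral_congr_ae (Eventually.of_forall fun θ => ?_)
    simp only [smul_eq_mul]
    ring
  have hcirc : ∀ θ, circleMap 0 (r / 4) θ ∈ closedBall (0 : ℂ) (r / 4) := fun θ =>
    circleMap_mem_closedBall 0 hr4.le θ
  have hd : DifferentiableAt ℂ (fun z => ∫ θ in Ioc (0 : ℝ) (2 * Real.pi),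
      ((2 * Real.pi * Complex.I : ℂ)⁻¹ *
        (deriv (circleMap 0 (r / 4)) θ * ((circleMap 0 (r / 4) θ - 0) ^ 2)⁻¹)) *
        f ((ContinuousLinearMap.id ℂ (Fin n → ℂ)) z + circleMap 0 (r / 4) θ • e)) z₀ := by
    have hK : IsCompact ((fun ζ : ℂ => z₀ + ζ • e) '' closedBall 0 (r / 4)) :=
      (isCompact_closedBall _ _).image (by fun_prop)
    have hne : ∀ θ, circleMap 0 (r / 4) θ ≠ 0 := fun θ => circleMap_ne_center hr4.ne'
    refine (hasFDerivAt_integral_comp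
      (A := fun _ => ContinuousLinearMap.id ℂ (Fin n → ℂ)) (U := U)
      (C := ‖(2 * Real.pi * Complex.I : ℂ)⁻¹‖ * ((r / 4) * ((r / 4) ^ 2)⁻¹))
      ?_ ?_ continuous_const ?_ ?_ hU hf hK ?_ ?_).2.differentiableAt
    · simp only [deriv_circleMap, sub_zero]
      refine continuous_const.mul (((continuous_circleMap 0 (r/4)).mul continuous_const).mul ?_)
      exact ((continuous_circleMap 0 (r/4)).pow 2).inv₀ fun θ => pow_ne_zero 2 (hne θ)
    · intro θ
      rw [norm_mul, norm_mul, norm_inv ((_ : ℂ) ^ 2), norm_pow]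
      simp [deriv_circleMap, abs_of_pos hr4]
    · intro θ; exact ContinuousLinearMap.norm_id_le
    · exact (continuous_circleMap 0 (r/4)).smul continuous_const
    · rintro _ ⟨ζ, hζ, rfl⟩
      exact hrU (key z₀ (mem_ball_self hr4) ζ (closedBall_subset_ball (by linarith) hζ))
    · intro θ; exact ⟨_, hcirc θ, rfl⟩
  refine hd.congr_of_eventuallyEq ?_
  filter_upwards [ball_mem_nhds z₀ hr4] with z hz
  rw [hformula z hz]; rfl

/-- The identity theorem on a connected open set. -/
theorem eqOn_zero_of_isPreconnected {E : Type*} [NormedAddCommGroup E] [NormedSpace ℂ E]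
    {U V : Set E} (hU : IsOpen U) (hUc : IsPreconnected U)
    {f : E → ℂ} (hf : DifferentiableOn ℂ f U) (hV : IsOpen V) (hVU : (U ∩ V).Nonempty)
    (h0 : ∀ z ∈ V, f z = 0) : ∀ z ∈ U, f z = 0 := by
  set W := {z | z ∈ U ∧ ∀ᶠ w in 𝓝 z, f w = 0}
  -- Vanishing near `q` spreads along the complex line from `q` to `w` by the one-variable identity
  -- theorem: its trace in the ball is convex, hence connected.
  have hball : ∀ p : E, ∀ r : ℝ, ball p r ⊆ U → ∀ q ∈ ball p r, (∀ᶠ w in 𝓝 q, f w = 0) →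
      ∀ w ∈ ball p r, f w = 0 := by
    intro p r hr q hq hq0 w hw
    set l : ℂ → E := fun ζ => q + ζ • (w - q)
    have hl : Continuous l := by fun_prop
    have hconv : Convex ℝ (l ⁻¹' ball p r) := by
      let : NormedSpace ℝ E := NormedSpace.restrictScalars ℝ ℂ E
      intro x hx y hy a b ha hb hab
      have : l (a • x + b • y) = a • l x + b • l y := by
        have hb' : b = 1 - a := by linarith
        have e1 : ∀ (c : ℝ) (v : E), c • v = (c : ℂ) • v := fun c v => rfl
        simp only [l, e1, Complex.real_smul, hb']
        push_cast
        module
      rw [mem_preimage, this]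
      exact convex_ball p r hx hy ha hb hab
    have han : AnalyticOnNhd ℂ (f ∘ l) (l ⁻¹' ball p r) := by
      refine DifferentiableOn.analyticOnNhd ?_ (isOpen_ball.preimage hl)
      refine (hf.mono hr).comp ?_ fun ζ hζ => hζ
      exact (by fun_prop : Differentiable ℂ l).differentiableOn
    have hl0 : l 0 = q := by simp [l]
    have hl1 : l 1 = w := by simp [l]
    have h := han.eqOn_zero_of_preconnected_of_eventuallyEq_zero hconv.isPreconnected
      (z₀ := 0) (by simpa [hl0] using hq) (by
        have : Tendsto l (𝓝 0) (𝓝 q) := by simpa [hl0] using hl.tendsto 0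
        exact this.eventually hq0)
    have := h (x := 1) (by simpa [hl1] using hw)
    simpa [hl1] using this
  have hWo : IsOpen W := by
    rw [isOpen_iff_mem_nhds]
    rintro z ⟨hz, hz0⟩
    filter_upwards [hU.mem_nhds hz, hz0.eventually_nhds] with w h1 h2 using ⟨h1, h2⟩
  have hsub : U ⊆ W := by
    refine hUc.subset_of_closure_inter_subset hWo ?_ ?_
    · obtain ⟨z, hz, hzV⟩ := hVU
      exact ⟨z, hz, hz, by filter_upwards [hV.mem_nhds hzV] with w hw using h0 w hw⟩
    · rintro p ⟨hp, hpU⟩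
      obtain ⟨r, hr, hrU⟩ := Metric.isOpen_iff.1 hU p hpU
      obtain ⟨q, hq, hqp⟩ := Metric.mem_closure_iff.1 hp r hr
      refine ⟨hpU, ?_⟩
      filter_upwards [ball_mem_nhds p hr] with w hw
      exact hball p r hrU q (by rwa [mem_ball, dist_comm]) hq.2 w hw
  exact fun z hz => (hsub hz).2.self_of_nhds

/-- A normally convergent series of holomorphic functions has a holomorphic sum. -/
theorem differentiableAt_tsum_of_bounded {E ι : Type*} [NormedAddCommGroup E] [NormedSpace ℂ E]
    {g : ι → E → ℂ} {u : ι → ℝ} (hu : Summable u) {z : E} {ρ : ℝ} (hρ : 0 < ρ)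
    (hg : ∀ i, DifferentiableOn ℂ (g i) (ball z ρ)) (hgu : ∀ i, ∀ w ∈ ball z ρ, ‖g i w‖ ≤ u i) :
    DifferentiableAt ℂ (fun w => ∑' i, g i w) z := by
  let : NormedSpace ℝ E := NormedSpace.restrictScalars ℝ ℂ E
  have hρ2 : 0 < ρ / 2 := by positivity
  have hsub : ∀ w ∈ ball z (ρ / 2), ball w (ρ / 2) ⊆ ball z ρ := fun w hw =>
    ball_subset_ball' (by linarith [mem_ball.1 hw])
  refine (hasFDerivAt_tsum_of_isPreconnected (s := ball z (ρ / 2)) (x₀ := z)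
    (u := fun i => (2 * u i) / (ρ / 2)) (f' := fun i => fderiv ℂ (g i))
    ((hu.mul_left 2).div_const _) isOpen_ball
    (convex_ball z _).isPreconnected ?_ ?_ (mem_ball_self hρ2) ?_
    (mem_ball_self hρ2)).differentiableAt
  · intro i x hx
    exact ((hg i).differentiableAt (isOpen_ball.mem_nhds
      (hsub x hx (mem_ball_self hρ2)))).hasFDerivAt
  · intro i x hx
    exact norm_fderiv_le_of_bounded hρ2 ((hg i).mono (hsub x hx)) fun w hw =>
      hgu i w (hsub x hx hw)
  · exact Summable.of_norm_bounded hu fun i => hgu i z (mem_ball_self hρ)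

/-! ### Torus action and homogeneous components -/

/-- The action of the torus on `ℂⁿ` by rotations of the coordinates. -/
noncomputable def rot (t : UnitAddTorus (Fin n)) (z : Fin n → ℂ) : Fin n → ℂ :=
  fun i => fourier 1 (t i) * z i

/-- The Laurent monomial `z^α`. -/
noncomputable def laurentMonomial (α : Fin n → ℤ) (z : Fin n → ℂ) : ℂ := ∏ i, z i ^ α i

/-- The normalised Haar measure on the torus. -/
noncomputable def torusMeasure (n : ℕ) : Measure (UnitAddTorus (Fin n)) :=
  Measure.pi fun _ => AddCircle.haarAddCircle

instance : IsProbabilityMeasure (torusMeasure n) := by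
  unfold torusMeasure; infer_instance

instance : (torusMeasure n).IsAddLeftInvariant := by
  unfold torusMeasure; infer_instance

instance : (torusMeasure n).IsAddRightInvariant := by
  unfold torusMeasure; infer_instance

/-- The `α`-homogeneous component of `f`: the Fourier coefficient of `f` on the torus
through `z`. -/
noncomputable def torusCoeff (f : (Fin n → ℂ) → ℂ) (α : Fin n → ℤ) (z : Fin n → ℂ) : ℂ :=
  UnitAddTorus.mFourierCoeff (fun t => f (rot t z)) α

theorem torusCoeff_eq_integral (f : (Fin n → ℂ) → ℂ) (α : Fin n → ℤ) (z : Fin n → ℂ) :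
    torusCoeff f α z = ∫ t, UnitAddTorus.mFourier (-α) t * f (rot t z) ∂torusMeasure n := rfl

theorem rot_mem {G : Set (Fin n → ℂ)} (hG : IsCircled G) (t : UnitAddTorus (Fin n))
    {z : Fin n → ℂ} (hz : z ∈ G) : rot t z ∈ G := by
  choose x hx using fun i => QuotientAddGroup.mk_surjective (t i)
  convert hG z hz (fun i => 2 * Real.pi * x i) using 2 with i
  rw [rot, ← hx i]
  erw [fourier_coe_apply]
  congr 2
  push_cast
  ring

theorem continuous_rot (z : Fin n → ℂ) : Continuous fun t : UnitAddTorus (Fin n) => rot t z := by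
  unfold rot; fun_prop

theorem rot_zero (z : Fin n → ℂ) : rot 0 z = z := by
  ext i; simp [rot]

theorem rot_rot (s t : UnitAddTorus (Fin n)) (z : Fin n → ℂ) :
    rot s (rot t z) = rot (s + t) z := by
  ext i
  simp only [rot, Pi.add_apply, fourier_apply, one_smul, AddCircle.toCircle_add, Circle.coe_mul]
  ring

theorem norm_rot_apply (t : UnitAddTorus (Fin n)) (z : Fin n → ℂ) (i : Fin n) :
    ‖rot t z i‖ = ‖z i‖ := by
  rw [rot, norm_mul, fourier_apply, Circle.norm_coe, one_mul]

theorem norm_mFourier_apply (α : Fin n → ℤ) (t : UnitAddTorus (Fin n)) :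
    ‖UnitAddTorus.mFourier α t‖ = 1 := by
  simp only [UnitAddTorus.mFourier, ContinuousMap.coe_mk, norm_prod, fourier_apply,
    Circle.norm_coe, Finset.prod_const_one]

/-- The rotation `rot t` as a continuous linear map. -/
noncomputable def rotL (t : UnitAddTorus (Fin n)) : (Fin n → ℂ) →L[ℂ] (Fin n → ℂ) :=
  ∑ i, (fourier 1 (t i) : ℂ) • (ContinuousLinearMap.single ℂ (fun _ : Fin n => ℂ) i).comp
    (ContinuousLinearMap.proj i)

theorem rotL_apply (t : UnitAddTorus (Fin n)) (z : Fin n → ℂ) : rotL t z = rot t z := by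
  ext i
  simp [rotL, rot, Finset.sum_apply, Pi.single_apply]

theorem continuous_rotL : Continuous (rotL : UnitAddTorus (Fin n) → _) := by
  unfold rotL; fun_prop

theorem norm_rotL_le (t : UnitAddTorus (Fin n)) : ‖rotL t‖ ≤ 1 := by
  refine ContinuousLinearMap.opNorm_le_bound _ zero_le_one fun z => ?_
  rw [rotL_apply, one_mul, pi_norm_le_iff_of_nonneg (norm_nonneg _)]
  intro i
  rw [norm_rot_apply]
  exact norm_le_pi_norm z i

theorem laurentMonomial_rot (α : Fin n → ℤ) (t : UnitAddTorus (Fin n)) (z : Fin n → ℂ) :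
    laurentMonomial α (rot t z) = UnitAddTorus.mFourier α t * laurentMonomial α z := by
  simp only [laurentMonomial, rot, mul_zpow, Finset.prod_mul_distrib, UnitAddTorus.mFourier,
    ContinuousMap.coe_mk]
  congr 1
  refine Finset.prod_congr rfl fun i _ => ?_
  simp [fourier_apply, AddCircle.toCircle_zsmul]

/-- Translation invariance of Haar measure. -/
theorem torusCoeff_rot (f : (Fin n → ℂ) → ℂ) (α : Fin n → ℤ) (s : UnitAddTorus (Fin n))
    (z : Fin n → ℂ) :
    torusCoeff f α (rot s z) = UnitAddTorus.mFourier α s * torusCoeff f α z := by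
  rw [torusCoeff_eq_integral, torusCoeff_eq_integral, ← integral_const_mul]
  rw [← integral_add_right_eq_self (μ := torusMeasure n)
    (fun t => UnitAddTorus.mFourier α s * (UnitAddTorus.mFourier (-α) t * f (rot t z))) s]
  refine integral_congr_ae (Eventually.of_forall fun t => ?_)
  have h1 : UnitAddTorus.mFourier (-α) (t + s) * UnitAddTorus.mFourier α s =
      UnitAddTorus.mFourier (-α) t := by
    simp only [UnitAddTorus.mFourier, ContinuousMap.coe_mk, ← Finset.prod_mul_distrib]
    refine Finset.prod_congr rfl fun i _ => ?_
    simp only [Pi.add_apply, Pi.neg_apply, fourier_apply, smul_add, AddCircle.toCircle_add,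
      neg_smul, AddCircle.toCircle_neg, Circle.coe_mul, Circle.coe_inv]
    have := Circle.coe_ne_zero (AddCircle.toCircle (α i • s i))
    field_simp
  simp only [rot_rot]
  rw [← h1]
  ring

theorem norm_torusCoeff_le {f : (Fin n → ℂ) → ℂ} {α : Fin n → ℤ} {z : Fin n → ℂ} {M : ℝ}
    (hM : ∀ t, ‖f (rot t z)‖ ≤ M) : ‖torusCoeff f α z‖ ≤ M := by
  rw [torusCoeff_eq_integral]
  refine (norm_integral_le_of_norm_le_const (C := M) (Eventually.of_forall fun t => ?_)).trans
    (by simp)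
  rw [norm_mul]
  rw [norm_mFourier_apply, one_mul]
  exact hM t

variable {G : Set (Fin n → ℂ)} {f : (Fin n → ℂ) → ℂ}

theorem isCompact_range_rot (z : Fin n → ℂ) :
    IsCompact (range fun t : UnitAddTorus (Fin n) => rot t z) :=
  isCompact_range (continuous_rot z)

theorem hasFDerivAt_torusCoeff (hG : IsOpen G) (hc : IsCircled G) (hf : f ∈ holomorphicOn G)
    (α : Fin n → ℤ) {z : Fin n → ℂ} (hz : z ∈ G) :
    Integrable (fun t => UnitAddTorus.mFourier (-α) t • (fderiv ℂ f (rot t z)).comp (rotL t))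
      (torusMeasure n) ∧
    HasFDerivAt (torusCoeff f α) (∫ t, UnitAddTorus.mFourier (-α) t •
      (fderiv ℂ f (rot t z)).comp (rotL t) ∂torusMeasure n) z := by
  have h := hasFDerivAt_integral_comp (μ := torusMeasure n)
    (k := UnitAddTorus.mFourier (-α)) (C := 1) (A := rotL)
    (b := fun _ => (0 : Fin n → ℂ)) (z₀ := z) (by fun_prop)
    (fun t => (norm_mFourier_apply _ t).le)
    continuous_rotL norm_rotL_le continuous_const hG hf (isCompact_range_rot z)
    (by rintro _ ⟨t, rfl⟩; exact rot_mem hc t hz)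
    (fun t => ⟨t, by simp [rotL_apply]⟩)
  simp only [add_zero, rotL_apply] at h
  exact h

theorem partialDeriv_torusCoeff (hG : IsOpen G) (hc : IsCircled G) (hf : f ∈ holomorphicOn G)
    (α : Fin n → ℤ) (j : Fin n) {z : Fin n → ℂ} (hz : z ∈ G) :
    partialDeriv j (torusCoeff f α) z = torusCoeff (partialDeriv j f) (α - Pi.single j 1) z := by
  obtain ⟨h1, h2⟩ := hasFDerivAt_torusCoeff hG hc hf α hz
  rw [partialDeriv, h2.fderiv, ContinuousLinearMap.integral_apply h1, torusCoeff_eq_integral]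
  refine integral_congr_ae (Eventually.of_forall fun t => ?_)
  have e1 : rotL t (Pi.single j 1) = (fourier 1 (t j) : ℂ) • Pi.single j (1 : ℂ) := by
    rw [rotL_apply]
    ext i
    by_cases h : i = j
    · subst h; simp [rot]
    · simp [rot, h]
  have e2 : UnitAddTorus.mFourier (-(α - Pi.single j 1)) t =
      UnitAddTorus.mFourier (-α) t * fourier 1 (t j) := by
    rw [neg_sub, sub_eq_add_neg, add_comm, UnitAddTorus.mFourier_add, UnitAddTorus.mFourier_single]
  simp only [smul_apply, ContinuousLinearMap.comp_apply, e1, map_smul, e2,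
    partialDeriv, smul_eq_mul]
  ring

/-- Euler's relation for a function which is homogeneous under rotations. -/
theorem euler_of_rot {g : (Fin n → ℂ) → ℂ} {β : Fin n → ℤ} {z : Fin n → ℂ}
    (hg : DifferentiableAt ℂ g z)
    (hrot : ∀ t, g (rot t z) = UnitAddTorus.mFourier β t * g z) (j : Fin n) :
    z j * partialDeriv j g z = β j * g z := by
  -- Only the `j`-th coordinate rotates along `γ`; differentiating `g ∘ γ` at `0` in two ways gives
  -- the relation, up to the factor `2πi`.
  set γ : ℝ → Fin n → ℂ := fun x => rot (Pi.single j (x : UnitAddCircle)) z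
  have hγ0 : γ 0 = z := by
    have : γ 0 = rot 0 z := by simp [γ]
    rw [this, rot_zero]
  have hγ : HasDerivAt γ ((2 * Real.pi * Complex.I * z j) • Pi.single j (1 : ℂ)) 0 := by
    rw [hasDerivAt_pi]
    intro i
    by_cases h : i = j
    · subst h
      have h1 := (hasDerivAt_fourier 1 1 (0 : ℝ)).mul_const (z i)
      simpa [γ, rot] using h1
    · simpa [γ, rot, h] using hasDerivAt_const (0 : ℝ) (z i)
  have h1 : HasDerivAt (g ∘ γ)
      (fderiv ℂ g z ((2 * Real.pi * Complex.I * z j) • Pi.single j (1 : ℂ))) 0 := by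
    have h2 : HasFDerivAt g ((fderiv ℂ g z).restrictScalars ℝ) (γ 0) := by
      rw [hγ0]; exact hg.hasFDerivAt.restrictScalars ℝ
    exact h2.comp_hasDerivAt 0 hγ
  have h3 : HasDerivAt (g ∘ γ) ((2 * Real.pi * Complex.I * β j) * g z) 0 := by
    have h4 := (hasDerivAt_fourier 1 (β j) (0 : ℝ)).mul_const (g z)
    have h5 : g ∘ γ = fun x : ℝ => fourier (β j) (x : UnitAddCircle) * g z := by
      ext x
      simp only [Function.comp_apply, γ, hrot]
      congr 1
      simp only [UnitAddTorus.mFourier, ContinuousMap.coe_mk]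
      rw [Finset.prod_eq_single j]
      · simp
      · intro i _ hi; simp [hi]
      · simp
    rw [h5]
    simpa using h4
  have h6 := h1.unique h3
  rw [map_smul, smul_eq_mul] at h6
  have h7 : (2 * Real.pi * Complex.I : ℂ) ≠ 0 := Complex.two_pi_I_ne_zero
  apply mul_left_cancel₀ h7
  rw [partialDeriv, ← mul_assoc, h6, mul_assoc]

/-! ### Laurent monomials and Laurent coefficients -/

theorem differentiableAt_laurentMonomial (α : Fin n → ℤ) {z : Fin n → ℂ}
    (hz : ∀ i, 0 ≤ α i ∨ z i ≠ 0) : DifferentiableAt ℂ (laurentMonomial α) z := by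
  unfold laurentMonomial
  exact (HasFDerivAt.finsetProd fun i _ => (DifferentiableAt.zpow (differentiableAt_apply i z)
    (hz i).symm).hasFDerivAt).differentiableAt

theorem laurentMonomial_ne_zero (α : Fin n → ℤ) {z : Fin n → ℂ} (hz : ∀ i, z i ≠ 0) :
    laurentMonomial α z ≠ 0 := Finset.prod_ne_zero_iff.2 fun i _ => zpow_ne_zero _ (hz i)

theorem dense_forall_ne_zero : Dense {z : Fin n → ℂ | ∀ i, z i ≠ 0} := by
  have : {z : Fin n → ℂ | ∀ i, z i ≠ 0} = univ.pi fun _ => ({0}ᶜ : Set ℂ) := by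
    ext z; simp
  rw [this]
  exact dense_pi _ fun i _ => dense_compl_singleton 0

theorem isOpen_forall_ne_zero : IsOpen {z : Fin n → ℂ | ∀ i, z i ≠ 0} := by
  simp only [ofPred_forall]
  exact isOpen_iInter_of_finite fun i => isOpen_ne_fun (continuous_apply i) continuous_const

/-- Near a point with nonzero coordinates, the `α`-homogeneous component is a multiple
of `z^α`. -/
theorem torusCoeff_eventually_eq (hG : IsOpen G) (hc : IsCircled G) (hf : f ∈ holomorphicOn G)
    (α : Fin n → ℤ) {z₀ : Fin n → ℂ} (hz₀ : z₀ ∈ G) (h0 : ∀ i, z₀ i ≠ 0) :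
    ∃ a : ℂ, ∀ᶠ z in 𝓝 z₀, torusCoeff f α z = a * laurentMonomial α z := by
  obtain ⟨r, hr, hrG⟩ := Metric.isOpen_iff.1 (hG.inter isOpen_forall_ne_zero) z₀ ⟨hz₀, h0⟩
  -- This quotient is invariant under rotations, so Euler's relation with exponent `0` kills all its
  -- partial derivatives.
  set h : (Fin n → ℂ) → ℂ := fun z => torusCoeff f α z * (laurentMonomial α z)⁻¹
  have hd : ∀ z ∈ ball z₀ r, DifferentiableAt ℂ h z := fun z hz =>
    (hasFDerivAt_torusCoeff hG hc hf α (hrG hz).1).2.differentiableAt.mul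
      ((differentiableAt_laurentMonomial α fun i => Or.inr ((hrG hz).2 i)).fun_inv
      (laurentMonomial_ne_zero α (hrG hz).2))
  have hzero : ∀ z ∈ ball z₀ r, fderiv ℂ h z = 0 := by
    intro z hz
    have hp : ∀ j, fderiv ℂ h z (Pi.single j 1) = 0 := by
      intro j
      have := euler_of_rot (β := 0) (hd z hz) (fun t => by
        have ht : UnitAddTorus.mFourier α t ≠ 0 := by
          rw [← norm_ne_zero_iff, norm_mFourier_apply]; exact one_ne_zero
        simp only [h, torusCoeff_rot, laurentMonomial_rot, UnitAddTorus.mFourier_zero,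
          ContinuousMap.one_apply, one_mul]
        rw [← div_eq_mul_inv, ← div_eq_mul_inv]
        exact mul_div_mul_left _ _ ht) j
      simpa [(hrG hz).2 j, partialDeriv] using this
    refine ContinuousLinearMap.coe_injective (LinearMap.pi_ext' fun j => LinearMap.ext_ring ?_)
    simpa using hp j
  have hconst : ∀ z ∈ ball z₀ r, h z₀ = h z := fun z hz =>
    isOpen_ball.is_const_of_fderiv_eq_zero (convex_ball z₀ r).isPreconnected
      (fun z hz => (hd z hz).differentiableWithinAt) (fun z hz => hzero z hz)
      (mem_ball_self hr) hz
  refine ⟨h z₀, ?_⟩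
  filter_upwards [ball_mem_nhds z₀ hr] with z hz
  rw [hconst z hz, inv_mul_cancel_right₀]
  exact laurentMonomial_ne_zero α (hrG hz).2

/-- Clearing denominators turns Laurent identities into polynomial ones, which survive on the
coordinate hyperplanes. -/
theorem laurentMonomial_neg_part_mul (α : Fin n → ℤ) {z : Fin n → ℂ}
    (hz : ∀ i, 0 ≤ α i ∨ z i ≠ 0) :
    (∏ i, z i ^ (-α i).toNat) * laurentMonomial α z = ∏ i, z i ^ (α i).toNat := by
  rw [laurentMonomial, ← Finset.prod_mul_distrib]
  refine Finset.prod_congr rfl fun i _ => ?_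
  rcases le_or_gt 0 (α i) with h | h
  · obtain ⟨m, hm⟩ := Int.eq_ofNat_of_zero_le h
    simp [hm]
  · have hzi := (hz i).resolve_left (not_le.2 h)
    obtain ⟨m, hm⟩ := Int.eq_ofNat_of_zero_le (by omega : 0 ≤ -α i)
    have hα : α i = -(m : ℤ) := by omega
    simp [hα, hzi]

/-- The homogeneous components of a holomorphic function on a circled domain are multiples of
Laurent monomials. -/
theorem exists_laurent_coeff (hG : IsComplexDomain G) (hc : IsCircled G)
    (hf : f ∈ holomorphicOn G) (α : Fin n → ℤ) :
    ∃ a : ℂ, ∀ z ∈ G, (∏ i, z i ^ (-α i).toNat) * torusCoeff f α z =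
      a * ∏ i, z i ^ (α i).toNat := by
  obtain ⟨z₀, hz₀, h0⟩ := dense_forall_ne_zero.inter_open_nonempty G hG.1 hG.2.nonempty
  obtain ⟨a, ha⟩ := torusCoeff_eventually_eq hG.1 hc hf α hz₀ h0
  refine ⟨a, fun z hz => sub_eq_zero.1 ?_⟩
  obtain ⟨V, hV, hVo, hzV⟩ := _root_.eventually_nhds_iff.1 (ha.and (isOpen_forall_ne_zero.mem_nhds h0))
  refine eqOn_zero_of_isPreconnected (f := fun z => (∏ i, z i ^ (-α i).toNat) * torusCoeff f α z -
      a * ∏ i, z i ^ (α i).toNat) hG.1 hG.2.isPreconnected ?_ hVo ⟨z₀, hz₀, hzV⟩ ?_ z hz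
  · intro w hw
    have h1 := (hasFDerivAt_torusCoeff hG.1 hc hf α hw).2.differentiableAt
    refine DifferentiableAt.differentiableWithinAt ?_
    refine DifferentiableAt.sub (DifferentiableAt.mul ?_ h1) (DifferentiableAt.const_mul ?_ _)
    · exact (HasFDerivAt.finsetProd fun i _ =>
        ((differentiableAt_apply i w).fun_pow _).hasFDerivAt).differentiableAt
    · exact (HasFDerivAt.finsetProd fun i _ =>
        ((differentiableAt_apply i w).fun_pow _).hasFDerivAt).differentiableAt
  · intro w hw
    obtain ⟨h1, h2⟩ := hV w hw
    rw [h1, ← laurentMonomial_neg_part_mul α fun i => Or.inr (h2 i)]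
    ring

/-- `a` is the coefficient of `z^α` in the Laurent expansion of `f` on `G`. -/
def IsLaurentCoeff (G : Set (Fin n → ℂ)) (f : (Fin n → ℂ) → ℂ) (α : Fin n → ℤ) (a : ℂ) : Prop :=
  ∀ z ∈ G, (∀ i, z i ≠ 0) → torusCoeff f α z = a * laurentMonomial α z

theorem exists_isLaurentCoeff (hG : IsComplexDomain G) (hc : IsCircled G)
    (hf : f ∈ holomorphicOn G) (α : Fin n → ℤ) : ∃ a, IsLaurentCoeff G f α a := by
  obtain ⟨a, ha⟩ := exists_laurent_coeff hG hc hf α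
  refine ⟨a, fun z hz h0 => ?_⟩
  have h1 := ha z hz
  have h2 : ∏ i, z i ^ (-α i).toNat ≠ 0 := Finset.prod_ne_zero_iff.2 fun i _ => pow_ne_zero _ (h0 i)
  rw [← laurentMonomial_neg_part_mul α fun i => Or.inr (h0 i)] at h1
  apply mul_left_cancel₀ h2
  rw [h1]; ring

theorem IsLaurentCoeff.eq {α : Fin n → ℤ} {a b : ℂ} (hG : IsOpen G) (hne : G.Nonempty)
    (ha : IsLaurentCoeff G f α a) (hb : IsLaurentCoeff G f α b) : a = b := by
  obtain ⟨z₀, hz₀, h0⟩ := dense_forall_ne_zero.inter_open_nonempty G hG hne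
  have := (ha z₀ hz₀ h0).symm.trans (hb z₀ hz₀ h0)
  exact mul_right_cancel₀ (laurentMonomial_ne_zero α h0) this

/-- If `G` meets `{z_j = 0}`, no negative power of `z_j` occurs in a Laurent expansion on `G`. -/
theorem IsLaurentCoeff.eq_zero_of_mem {α : Fin n → ℤ} {a : ℂ} (hG : IsComplexDomain G)
    (hc : IsCircled G) (hf : f ∈ holomorphicOn G) (ha : IsLaurentCoeff G f α a) {j : Fin n}
    (hj : ∃ p ∈ G, p j = 0) (hα : α j < 0) : a = 0 := by
  obtain ⟨b, hb⟩ := exists_laurent_coeff hG hc hf α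
  have hba : IsLaurentCoeff G f α b := by
    intro z hz h0
    have h1 := hb z hz
    have h2 : ∏ i, z i ^ (-α i).toNat ≠ 0 :=
      Finset.prod_ne_zero_iff.2 fun i _ => pow_ne_zero _ (h0 i)
    rw [← laurentMonomial_neg_part_mul α fun i => Or.inr (h0 i)] at h1
    apply mul_left_cancel₀ h2
    rw [h1]; ring
  rw [ha.eq hG.1 hG.2.nonempty hba]
  obtain ⟨p, hp, hpj⟩ := hj
  -- At a point of `G` where only the `j`-th coordinate vanishes, the left side of `hb` is zero,
  -- while the monomial on the right is not, since `(α j).toNat = 0`.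
  have hcont : Continuous fun w : Fin n → ℂ => Function.update w j (0 : ℂ) :=
    continuous_id.update j continuous_const
  obtain ⟨w, hw, hw0⟩ := dense_forall_ne_zero.inter_open_nonempty _ (hG.1.preimage hcont)
    ⟨p, by rw [mem_preimage, ← hpj, Function.update_eq_self]; exact hp⟩
  have h := hb _ hw
  rw [Finset.prod_eq_zero (Finset.mem_univ j) (by simp [hα]), zero_mul] at h
  refine (mul_eq_zero.1 h.symm).resolve_right (Finset.prod_ne_zero_iff.2 fun i _ => ?_)
  by_cases hij : i = j
  · subst hij
    have : (α i).toNat = 0 := by omega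
    simp [this]
  · simp only [Function.update_of_ne hij]
    exact pow_ne_zero _ (hw0 i)

theorem laurentMonomial_sub_single (α : Fin n → ℤ) (j : Fin n) {z : Fin n → ℂ}
    (hz : ∀ i, z i ≠ 0) :
    z j * laurentMonomial (α - Pi.single j 1) z = laurentMonomial α z := by
  have : (∏ i, z i ^ (Pi.single j (1 : ℤ) : Fin n → ℤ) i) = z j := by
    rw [Finset.prod_eq_single j] <;> simp +contextual
  simp only [laurentMonomial, Pi.sub_apply, zpow_sub₀ (hz _), Finset.prod_div_distrib, this]
  have := hz j
  field_simp

theorem IsLaurentCoeff.partialDeriv {α : Fin n → ℤ} {a : ℂ} (hG : IsOpen G)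
    (hc : IsCircled G) (hf : f ∈ holomorphicOn G) (ha : IsLaurentCoeff G f α a) (j : Fin n) :
    IsLaurentCoeff G (partialDeriv j f) (α - Pi.single j 1) (α j * a) := by
  intro z hz h0
  rw [← partialDeriv_torusCoeff hG hc hf α j hz]
  have h1 := euler_of_rot (hasFDerivAt_torusCoeff hG hc hf α hz).2.differentiableAt
    (fun t => torusCoeff_rot f α t z) j
  apply mul_left_cancel₀ (h0 j)
  rw [h1, ha z hz h0, ← laurentMonomial_sub_single α j h0]
  ring

/-! ### Logarithmic image and convergence of Laurent series -/

/-- The coordinatewise logarithm of the absolute value. -/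
noncomputable def logNorm (z : Fin n → ℂ) : Fin n → ℝ := fun i => Real.log ‖z i‖

/-- The point of the positive orthant with prescribed logarithm. -/
noncomputable def expPoint (x : Fin n → ℝ) : Fin n → ℂ := fun i => (Real.exp (x i) : ℂ)

/-- The logarithmic image of `G`. -/
def logSet (G : Set (Fin n → ℂ)) : Set (Fin n → ℝ) := expPoint ⁻¹' G

/-- The points with nonzero coordinates whose logarithmic image lies in `Y`. -/
def logPreimage (Y : Set (Fin n → ℝ)) : Set (Fin n → ℂ) :=
  {z | (∀ i, z i ≠ 0) ∧ logNorm z ∈ Y}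

theorem expPoint_ne_zero (x : Fin n → ℝ) (i : Fin n) : expPoint x i ≠ 0 := by
  simp [expPoint]

theorem logNorm_expPoint (x : Fin n → ℝ) : logNorm (expPoint x) = x := by
  ext i; simp [logNorm, expPoint]

theorem expPoint_logNorm_apply {z : Fin n → ℂ} (hz : ∀ i, z i ≠ 0) (i : Fin n) :
    expPoint (logNorm z) i = (‖z i‖ : ℂ) := by
  simp only [expPoint, logNorm]
  rw [Real.exp_log (norm_pos_iff.2 (hz i))]

theorem logNorm_mem_logSet_iff (hc : IsCircled G) {z : Fin n → ℂ} (hz : ∀ i, z i ≠ 0) :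
    logNorm z ∈ logSet G ↔ z ∈ G := by
  constructor
  · intro h
    convert hc _ h fun i => (z i).arg using 2 with i
    rw [expPoint_logNorm_apply hz, mul_comm, Complex.norm_mul_exp_arg_mul_I]
  · intro h
    rw [logSet, mem_preimage]
    convert hc _ h fun i => -(z i).arg using 2 with i
    rw [expPoint_logNorm_apply hz]
    conv_rhs => rw [← Complex.norm_mul_exp_arg_mul_I (z i)]
    rw [mul_left_comm, ← Complex.exp_add]
    push_cast
    simp

theorem continuous_expPoint : Continuous (expPoint : (Fin n → ℝ) → Fin n → ℂ) := by
  unfold expPoint; fun_prop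

theorem isOpen_logSet (hG : IsOpen G) : IsOpen (logSet G) := hG.preimage continuous_expPoint

theorem logSet_nonempty (hG : IsComplexDomain G) (hc : IsCircled G) : (logSet G).Nonempty := by
  obtain ⟨z₀, hz₀, h0⟩ := dense_forall_ne_zero.inter_open_nonempty G hG.1 hG.2.nonempty
  exact ⟨_, (logNorm_mem_logSet_iff hc h0).2 hz₀⟩

theorem continuousAt_logNorm {z : Fin n → ℂ} (hz : ∀ i, z i ≠ 0) : ContinuousAt logNorm z := by
  refine continuousAt_pi.2 fun i => ?_
  exact (continuous_apply i).continuousAt.norm.log (norm_ne_zero_iff.2 (hz i))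

theorem isOpen_logPreimage {Y : Set (Fin n → ℝ)} (hY : IsOpen Y) : IsOpen (logPreimage Y) := by
  rw [isOpen_iff_mem_nhds]
  rintro z ⟨hz, hzY⟩
  filter_upwards [isOpen_forall_ne_zero.mem_nhds hz,
    (continuousAt_logNorm hz).eventually_mem (hY.mem_nhds hzY)] with w h1 h2 using ⟨h1, h2⟩

theorem expPoint_mem_logPreimage {Y : Set (Fin n → ℝ)} {y : Fin n → ℝ} (hy : y ∈ Y) :
    expPoint y ∈ logPreimage Y :=
  ⟨expPoint_ne_zero y, by rwa [logNorm_expPoint]⟩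

/-- It is the image of the convex tube `Re w ∈ Y` under the coordinatewise exponential. -/
theorem isConnected_logPreimage {Y : Set (Fin n → ℝ)} (hY : Convex ℝ Y) (hne : Y.Nonempty) :
    IsConnected (logPreimage Y) := by
  obtain ⟨y, hy⟩ := hne
  refine ⟨⟨_, expPoint_mem_logPreimage hy⟩, ?_⟩
  have h1 : Convex ℝ {w : Fin n → ℂ | (fun i => (w i).re) ∈ Y} := by
    intro v hv w hw a b ha hb hab
    have : (fun i => ((a • v + b • w) i).re) =
        a • (fun i => (v i).re) + b • fun i => (w i).re := by ext i; simp
    rw [mem_ofPred_eq, this]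
    exact hY hv hw ha hb hab
  have h2 : logPreimage Y = (fun w : Fin n → ℂ => fun i => Complex.exp (w i)) ''
      {w : Fin n → ℂ | (fun i => (w i).re) ∈ Y} := by
    ext z
    constructor
    · rintro ⟨hz, hzY⟩
      refine ⟨fun i => Complex.log (z i), ?_, ?_⟩
      · simp only [mem_ofPred_eq, Complex.log_re]
        exact hzY
      · ext i; exact Complex.exp_log (hz i)
    · rintro ⟨w, hw, rfl⟩
      refine ⟨fun i => Complex.exp_ne_zero _, ?_⟩
      have : logNorm (fun i => Complex.exp (w i)) = fun i => (w i).re := by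
        ext i; simp [logNorm, Complex.norm_exp]
      rw [this]
      exact hw
  rw [h2]
  exact h1.isPreconnected.image _ (by fun_prop)

theorem norm_laurentMonomial (α : Fin n → ℤ) {z : Fin n → ℂ} (hz : ∀ i, z i ≠ 0) :
    ‖laurentMonomial α z‖ = Real.exp (∑ i, α i * logNorm z i) := by
  rw [laurentMonomial, norm_prod, Real.exp_sum]
  refine Finset.prod_congr rfl fun i _ => ?_
  rw [norm_zpow, mul_comm, Real.exp_mul, logNorm, Real.exp_log (norm_pos_iff.2 (hz i)),
    Real.rpow_intCast]

/-- The coefficients `a` are bounded with respect to the monomials at the point `exp x`. -/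
def CoeffBounded (a : (Fin n → ℤ) → ℂ) (x : Fin n → ℝ) : Prop :=
  ∃ C : ℝ, ∀ α, ‖a α‖ * Real.exp (∑ i, α i * x i) ≤ C

/-- Each Laurent term is an average of `f` over a compact torus orbit, so the maximum of `|f|` there
bounds all terms at once. -/
theorem coeffBounded_of_mem_logSet (hc : IsCircled G) (hf : f ∈ holomorphicOn G)
    {a : (Fin n → ℤ) → ℂ} (ha : ∀ α, IsLaurentCoeff G f α (a α)) {x : Fin n → ℝ}
    (hx : x ∈ logSet G) : CoeffBounded a x := by
  have hf : DifferentiableOn ℂ f G := hf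
  have hcont : ContinuousOn f (range fun t : UnitAddTorus (Fin n) => rot t (expPoint x)) :=
    hf.continuousOn.mono (by rintro _ ⟨t, rfl⟩; exact rot_mem hc t hx)
  obtain ⟨C, hC⟩ := (isCompact_range_rot (expPoint x)).exists_bound_of_continuousOn hcont
  refine ⟨C, fun α => ?_⟩
  have h1 := norm_laurentMonomial α (expPoint_ne_zero x)
  rw [logNorm_expPoint] at h1
  rw [← h1, ← norm_mul, ← ha α _ hx (expPoint_ne_zero x)]
  exact norm_torusCoeff_le fun t => hC _ ⟨t, rfl⟩

/-- The source of logarithmic convexity: `x ↦ exp⟨α, x⟩` is convex, so bounds at two points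
interpolate uniformly in `α`. -/
theorem convex_setOf_coeffBounded (a : (Fin n → ℤ) → ℂ) : Convex ℝ {x | CoeffBounded a x} := by
  rintro x ⟨C, hC⟩ y ⟨D, hD⟩ s t hs ht hst
  refine ⟨s * C + t * D, fun α => ?_⟩
  have h1 : ∑ i, (α i : ℝ) * (s • x + t • y) i =
      s • (∑ i, (α i : ℝ) * x i) + t • ∑ i, (α i : ℝ) * y i := by
    simp only [Pi.add_apply, Pi.smul_apply, smul_eq_mul, Finset.mul_sum, ← Finset.sum_add_distrib]
    exact Finset.sum_congr rfl fun i _ => by ring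
  have h2 := convexOn_exp.2 (mem_univ (∑ i, (α i : ℝ) * x i))
    (mem_univ (∑ i, (α i : ℝ) * y i)) hs ht hst
  rw [h1]
  calc ‖a α‖ * Real.exp (s • (∑ i, (α i : ℝ) * x i) + t • ∑ i, (α i : ℝ) * y i)
      ≤ ‖a α‖ * (s • Real.exp (∑ i, (α i : ℝ) * x i) + t • Real.exp (∑ i, (α i : ℝ) * y i)) := by
        gcongr
    _ = s * (‖a α‖ * Real.exp (∑ i, (α i : ℝ) * x i)) +
        t * (‖a α‖ * Real.exp (∑ i, (α i : ℝ) * y i)) := by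
        simp only [smul_eq_mul]; ring
    _ ≤ s * C + t * D := by gcongr <;> simp [hC, hD]

theorem summable_exp_neg_sum_abs {δ : ℝ} (hδ : 0 < δ) :
    Summable fun α : Fin n → ℤ => Real.exp (-δ * ∑ i, |(α i : ℝ)|) := by
  have h1 : Summable fun m : ℤ => Real.exp (-δ * |(m : ℝ)|) := by
    have h2 : Summable fun m : ℕ => Real.exp (-δ * |((m : ℤ) : ℝ)|) := by
      have := Real.summable_exp_nat_mul_iff.2 (neg_neg_of_pos hδ)
      refine this.congr fun m => ?_
      simp [mul_comm]
    refine Summable.of_nat_of_neg h2 ?_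
    simpa using h2
  have h3 : ∀ α : Fin n → ℤ, Real.exp (-δ * ∑ i, |(α i : ℝ)|) =
      ∏ i, Real.exp (-δ * |(α i : ℝ)|) := by
    intro α
    rw [Finset.mul_sum, Real.exp_sum]
  simp only [h3]
  refine summable_of_sum_le (c := ∏ _i : Fin n, ∑' m : ℤ, Real.exp (-δ * |(m : ℝ)|))
    (fun α => Finset.prod_nonneg fun i _ => (Real.exp_pos _).le) fun u => ?_
  -- Enclosing `u` in a box makes the sum factor into one-variable geometric sums.
  have hsub : u ⊆ Fintype.piFinset fun i => u.image fun α => α i := by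
    intro α hα
    rw [Fintype.mem_piFinset]
    exact fun i => Finset.mem_image_of_mem _ hα
  refine (Finset.sum_le_sum_of_subset_of_nonneg hsub
    fun α _ _ => Finset.prod_nonneg fun i _ => (Real.exp_pos _).le).trans ?_
  rw [← Finset.prod_univ_sum (fun i => u.image fun α : Fin n → ℤ => α i)
    fun _ (m : ℤ) => Real.exp (-δ * |(m : ℝ)|)]
  refine Finset.prod_le_prod (fun i _ => Finset.sum_nonneg fun m _ => (Real.exp_pos _).le)
    fun i _ => ?_
  exact h1.sum_le_tsum _ fun m _ => (Real.exp_pos _).le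

/-- Coefficients bounded on an open set give a normally convergent Laurent series. -/
theorem exists_summable_bound {a : (Fin n → ℤ) → ℂ} {Y : Set (Fin n → ℝ)} (hY : IsOpen Y)
    (ha : ∀ y ∈ Y, CoeffBounded a y) {z₀ : Fin n → ℂ} (hz₀ : z₀ ∈ logPreimage Y) :
    ∃ ρ > 0, ∃ u : (Fin n → ℤ) → ℝ, Summable u ∧
      ∀ w ∈ ball z₀ ρ, (∀ i, w i ≠ 0) ∧ ∀ α, ‖a α * laurentMonomial α w‖ ≤ u α := by
  obtain ⟨h0, hy⟩ := hz₀
  set y := logNorm z₀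
  obtain ⟨ε, hε, hεY⟩ := Metric.isOpen_iff.1 hY y hy
  set δ := ε / 2
  have hδ : 0 < δ := by positivity
  -- Bounds at the `2^n` vertices of a cube suffice: for each `α`, the vertex with the signs of `α`
  -- gains the factor `exp(δ ∑ |α_i|)`. Moving by `δ / 2` in logarithmic coordinates later costs
  -- only half of the exponent.
  have hvert : ∀ σ : Fin n → Bool, (fun i => y i + δ * (if σ i then 1 else -1)) ∈ Y := by
    intro σ
    apply hεY
    rw [mem_ball, dist_pi_lt_iff hε]
    intro i
    rw [Real.dist_eq, add_sub_cancel_left, abs_mul, abs_of_pos hδ]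
    split_ifs <;> simp [δ] <;> linarith
  choose C hC using fun σ => ha _ (hvert σ)
  have hC0 : ∀ σ, 0 ≤ C σ := fun σ => le_trans (by positivity) (hC σ 0)
  have hbound : ∀ α, ‖a α‖ * Real.exp (∑ i, α i * y i + δ * ∑ i, |(α i : ℝ)|) ≤ ∑ σ, C σ := by
    intro α
    refine le_trans ?_ (Finset.single_le_sum (fun σ _ => hC0 σ)
      (Finset.mem_univ fun i => decide (0 ≤ α i)))
    refine le_of_eq_of_le ?_ (hC (fun i => decide (0 ≤ α i)) α)
    congr 2
    rw [Finset.mul_sum, ← Finset.sum_add_distrib]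
    refine Finset.sum_congr rfl fun i _ => ?_
    by_cases h : 0 ≤ α i
    · have h' : (0 : ℝ) ≤ α i := by exact_mod_cast h
      simp [h, abs_of_nonneg h']; ring
    · have h' : (α i : ℝ) ≤ 0 := by exact_mod_cast (not_le.1 h).le
      simp [h, abs_of_nonpos h']; ring
  have hev : ∀ᶠ w in 𝓝 z₀, (∀ i, w i ≠ 0) ∧ logNorm w ∈ ball y (δ / 2) := by
    filter_upwards [isOpen_forall_ne_zero.mem_nhds h0,
      (continuousAt_logNorm h0).eventually_mem (ball_mem_nhds _ (by positivity : 0 < δ / 2))] with w h1 h2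
      using ⟨h1, h2⟩
  obtain ⟨ρ, hρ, hball⟩ := Metric.eventually_nhds_iff_ball.1 hev
  refine ⟨ρ, hρ, fun α => (∑ σ, C σ) * Real.exp (-(δ / 2) * ∑ i, |(α i : ℝ)|),
    (summable_exp_neg_sum_abs (by positivity)).mul_left _, fun w hw => ⟨(hball w hw).1, ?_⟩⟩
  intro α
  obtain ⟨hw0, hwy⟩ := hball w hw
  have hle : ∑ i, (α i : ℝ) * logNorm w i ≤ (∑ i, (α i : ℝ) * y i + δ * ∑ i, |(α i : ℝ)|) +
      (-(δ / 2) * ∑ i, |(α i : ℝ)|) := by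
    have h1 : ∀ i, (α i : ℝ) * logNorm w i ≤ α i * y i + δ / 2 * |(α i : ℝ)| := by
      intro i
      have h2 : |logNorm w i - y i| ≤ δ / 2 := by
        rw [← Real.dist_eq]
        exact (dist_le_pi_dist _ _ i).trans (mem_ball.1 hwy).le
      have h3 : (α i : ℝ) * (logNorm w i - y i) ≤ |(α i : ℝ)| * (δ / 2) := by
        refine (le_abs_self _).trans ?_
        rw [abs_mul]
        gcongr
      linarith
    calc ∑ i, (α i : ℝ) * logNorm w i ≤ ∑ i, (α i * y i + δ / 2 * |(α i : ℝ)|) :=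
          Finset.sum_le_sum fun i _ => h1 i
      _ = _ := by rw [Finset.sum_add_distrib, ← Finset.mul_sum]; ring
  rw [norm_mul, norm_laurentMonomial α hw0]
  calc ‖a α‖ * Real.exp (∑ i, (α i : ℝ) * logNorm w i)
      ≤ ‖a α‖ * (Real.exp (∑ i, (α i : ℝ) * y i + δ * ∑ i, |(α i : ℝ)|) *
        Real.exp (-(δ / 2) * ∑ i, |(α i : ℝ)|)) := by
        rw [← Real.exp_add]
        exact mul_le_mul_of_nonneg_left (Real.exp_le_exp.2 hle) (norm_nonneg _)
    _ = (‖a α‖ * Real.exp (∑ i, (α i : ℝ) * y i + δ * ∑ i, |(α i : ℝ)|)) *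
        Real.exp (-(δ / 2) * ∑ i, |(α i : ℝ)|) := by ring
    _ ≤ _ := mul_le_mul_of_nonneg_right (hbound α) (Real.exp_pos _).le

/-- The Laurent series of `f` converges to `f` wherever it converges absolutely. -/
theorem tsum_laurent_eq (hc : IsCircled G) (hf : f ∈ holomorphicOn G)
    {a : (Fin n → ℤ) → ℂ} (ha : ∀ α, IsLaurentCoeff G f α (a α)) {z : Fin n → ℂ} (hz : z ∈ G)
    (h0 : ∀ i, z i ≠ 0) (hs : Summable fun α => a α * laurentMonomial α z) :
    ∑' α, a α * laurentMonomial α z = f z := by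
  have hf : DifferentiableOn ℂ f G := hf
  have hcont : Continuous fun t : UnitAddTorus (Fin n) => f (rot t z) :=
    hf.continuousOn.comp_continuous (continuous_rot z) fun t => rot_mem hc t hz
  have h1 : (fun α => a α * laurentMonomial α z) =
      UnitAddTorus.mFourierCoeff (⟨_, hcont⟩ : C(UnitAddTorus (Fin n), ℂ)) := by
    ext α
    exact (ha α z hz h0).symm
  -- The Laurent series at `z` is the Fourier series of `t ↦ f (rot t z)` evaluated at `t = 0`.
  have h2 := UnitAddTorus.hasSum_mFourier_series_apply_of_summable
    (f := ⟨_, hcont⟩) (h1 ▸ hs) 0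
  rw [← h1] at h2
  simp only [ContinuousMap.coe_mk, rot_zero] at h2
  rw [← h2.tsum_eq]
  refine tsum_congr fun α => ?_
  simp [UnitAddTorus.mFourier]

/-! ### Logarithmic convexity and completeness -/

/-- If the Laurent coefficients of all members of `F` are bounded over an open convex set `Y`
meeting the logarithmic image of `G`, then `Y` is contained in the logarithmic image. -/
theorem subset_logSet_of_coeffBounded {F : Set ((Fin n → ℂ) → ℂ)} (hF : F ⊆ holomorphicOn G)
    (hG : IsComplexDomain G) (hc : IsCircled G) (hD : IsDomainOfHolomorphyFor F G)
    {Y : Set (Fin n → ℝ)} (hYo : IsOpen Y) (hYc : Convex ℝ Y) (hXY : (logSet G ∩ Y).Nonempty)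
    (hb : ∀ f ∈ F, ∀ a : (Fin n → ℤ) → ℂ, (∀ α, IsLaurentCoeff G f α (a α)) →
      ∀ y ∈ Y, CoeffBounded a y) : Y ⊆ logSet G := by
  by_contra hnot
  obtain ⟨y, hy, hyX⟩ := not_subset.1 hnot
  obtain ⟨x₀, hx₀⟩ := hXY
  obtain ⟨r, hr, hrX⟩ := Metric.isOpen_iff.1 ((isOpen_logSet hG.1).inter hYo) x₀ hx₀
  refine hD ⟨logPreimage (ball x₀ r), logPreimage Y, ⟨isOpen_logPreimage isOpen_ball,
    isConnected_logPreimage (convex_ball _ _) ⟨x₀, mem_ball_self hr⟩⟩,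
    ⟨isOpen_logPreimage hYo, isConnected_logPreimage hYc ⟨y, hy⟩⟩, ?_, ?_, ?_⟩
  · rintro z ⟨hz, hzr⟩
    exact ⟨(logNorm_mem_logSet_iff hc hz).1 (hrX hzr).1, hz, (hrX hzr).2⟩
  · intro hsub
    exact hyX (hsub (expPoint_mem_logPreimage hy))
  · intro f hfF
    choose a ha using exists_isLaurentCoeff hG hc (hF hfF)
    refine ⟨fun z => ∑' α, a α * laurentMonomial α z, fun z hz => ?_, ?_⟩
    · obtain ⟨ρ, hρ, u, hu, hbu⟩ := exists_summable_bound hYo (hb f hfF a ha) hz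
      refine (differentiableAt_tsum_of_bounded hu hρ (fun α w hw => ?_)
        fun α w hw => (hbu w hw).2 α).differentiableWithinAt
      exact ((differentiableAt_laurentMonomial α fun i =>
        Or.inr ((hbu w hw).1 i)).const_mul _).differentiableWithinAt
    · rintro z ⟨hz, hzr⟩
      obtain ⟨ρ, hρ, u, hu, hbu⟩ := exists_summable_bound hYo (hb f hfF a ha)
        (⟨hz, (hrX hzr).2⟩ : z ∈ logPreimage Y)
      exact tsum_laurent_eq hc (hF hfF) ha ((logNorm_mem_logSet_iff hc hz).1 (hrX hzr).1) hz
        (Summable.of_norm_bounded hu (hbu z (mem_ball_self hρ)).2)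

/-- A circled domain of holomorphy is logarithmically convex. -/
theorem convex_logSet {F : Set ((Fin n → ℂ) → ℂ)} (hF : F ⊆ holomorphicOn G)
    (hG : IsComplexDomain G) (hc : IsCircled G) (hD : IsDomainOfHolomorphyFor F G) :
    Convex ℝ (logSet G) := by
  obtain ⟨x, hx⟩ := logSet_nonempty hG hc
  have h : convexHull ℝ (logSet G) ⊆ logSet G :=
    subset_logSet_of_coeffBounded hF hG hc hD (isOpen_logSet hG.1).convexHull
      (convex_convexHull ℝ _) ⟨x, hx, subset_convexHull ℝ _ hx⟩ fun f hf a ha =>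
        convexHull_min (fun y hy => coeffBounded_of_mem_logSet hc (hF hf) ha hy)
          (convex_setOf_coeffBounded a)
  rw [← h.antisymm (subset_convexHull ℝ _)]
  exact convex_convexHull ℝ _

/-- If no member of `F` has negative powers of `z_j` in its Laurent expansion, then the
logarithmic image of `G` is invariant under lowering the `j`-th coordinate. -/
theorem sub_single_mem_logSet {F : Set ((Fin n → ℂ) → ℂ)} (hF : F ⊆ holomorphicOn G)
    (hG : IsComplexDomain G) (hc : IsCircled G) (hD : IsDomainOfHolomorphyFor F G) {j : Fin n}
    (hj : ∀ f ∈ F, ∀ α a, IsLaurentCoeff G f α a → α j < 0 → a = 0) {x : Fin n → ℝ}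
    (hx : x ∈ logSet G) {s : ℝ} (hs : 0 ≤ s) : x - Pi.single j s ∈ logSet G := by
  have hX := convex_logSet hF hG hc hD
  -- The points below `log G` in direction `j`. Lowering `y_j` does not increase a term with `α_j ≥
  -- 0`, and the other terms vanish by `hj`.
  set Y : Set (Fin n → ℝ) := {y | ∃ s : ℝ, 0 ≤ s ∧ y + Pi.single j s ∈ logSet G}
  have hY : Y ⊆ logSet G := by
    refine subset_logSet_of_coeffBounded hF hG hc hD ?_ ?_ ⟨x, hx, 0, le_rfl, by simpa⟩ ?_
    · have : Y = ⋃ s ∈ Ici (0 : ℝ), (fun y => y + Pi.single j s) ⁻¹' logSet G := by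
        ext y; simp [Y]
      rw [this]
      exact isOpen_biUnion fun s _ => (isOpen_logSet hG.1).preimage (by fun_prop)
    · rintro y ⟨s, hs, hy⟩ z ⟨t, ht, hz⟩ a b ha hb hab
      refine ⟨a * s + b * t, by positivity, ?_⟩
      convert hX hy hz ha hb hab using 1
      ext i
      by_cases h : i = j
      · subst h; simp; ring
      · simp [h]
    · rintro f hf a ha y ⟨s, hs, hy⟩
      obtain ⟨C, hC⟩ := coeffBounded_of_mem_logSet hc (hF hf) ha hy
      refine ⟨C, fun α => ?_⟩
      rcases lt_or_ge (α j) 0 with h | h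
      · have := hC α
        rw [hj f hf α _ (ha α) h, norm_zero, zero_mul] at this ⊢
        exact this
      · refine le_trans ?_ (hC α)
        refine mul_le_mul_of_nonneg_left (Real.exp_le_exp.2
          (Finset.sum_le_sum fun i _ => ?_)) (norm_nonneg _)
        by_cases hi : i = j
        · subst hi
          have : (0 : ℝ) ≤ α i := by exact_mod_cast h
          simp only [Pi.add_apply, Pi.single_eq_same]
          nlinarith
        · simp [hi]
  exact hY ⟨s, hs, by simpa⟩

/-- If moreover `G` is fat, it is complete in the `j`-th coordinate. -/
theorem update_mem_of_coeff_eq_zero {F : Set ((Fin n → ℂ) → ℂ)} (hF : F ⊆ holomorphicOn G)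
    (hG : IsComplexDomain G) (hc : IsCircled G) (hfat : IsFat G)
    (hD : IsDomainOfHolomorphyFor F G) {j : Fin n}
    (hj : ∀ f ∈ F, ∀ α a, IsLaurentCoeff G f α a → α j < 0 → a = 0) {z : Fin n → ℂ}
    (hz : z ∈ G) {w : ℂ} (hw : ‖w‖ ≤ ‖z j‖) : Function.update z j w ∈ G := by
  -- The strict inequality makes `H` open. Off the hyperplanes `H` lies in `G` by the logarithmic
  -- argument, and fatness adds the remaining points.
  set H : Set (Fin n → ℂ) := ⋃ c : ℂ, {v | ‖v j‖ < ‖c‖ ∧ Function.update v j c ∈ G}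
  have hupd : ∀ c : ℂ, Continuous fun v : Fin n → ℂ => Function.update v j c := fun c =>
    continuous_id.update j continuous_const
  have hHo : IsOpen H := isOpen_iUnion fun c =>
    (isOpen_lt (continuous_apply j).norm continuous_const).inter (hG.1.preimage (hupd c))
  have hH : H ∩ {v | ∀ i, v i ≠ 0} ⊆ G := by
    rintro v ⟨hv, hv0⟩
    obtain ⟨c, hvc, hcG⟩ := mem_iUnion.1 hv
    have hc0 : c ≠ 0 := norm_pos_iff.1 ((norm_nonneg _).trans_lt hvc)
    have h0 : ∀ i, Function.update v j c i ≠ 0 := by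
      intro i
      by_cases h : i = j
      · subst h; simpa
      · simpa [h] using hv0 i
    rw [← logNorm_mem_logSet_iff hc hv0]
    have h1 := sub_single_mem_logSet hF hG hc hD hj ((logNorm_mem_logSet_iff hc h0).2 hcG)
      (s := Real.log ‖c‖ - Real.log ‖v j‖)
      (sub_nonneg.2 (Real.log_le_log (norm_pos_iff.2 (hv0 j)) hvc.le))
    convert h1 using 1
    ext i
    by_cases h : i = j
    · subst h; simp [logNorm]
    · simp [logNorm, h]
  have hHG : H ⊆ G := by
    rw [hfat]
    refine interior_maximal ?_ hHo
    exact (dense_forall_ne_zero.open_subset_closure_inter hHo).trans (closure_mono hH)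
  refine hHG (mem_iUnion.2 ?_)
  have hcont : Continuous fun c : ℂ => Function.update z j c := continuous_const.update j continuous_id
  obtain ⟨r, hr, hrG⟩ := Metric.isOpen_iff.1 (hG.1.preimage hcont) (z j) (by simpa using hz)
  -- Openness of `G` allows `|z_j|` to be increased slightly, so that `‖w‖ = ‖z j‖` is also covered
  -- by `H`.
  obtain ⟨c, hcr, hcz⟩ : ∃ c ∈ ball (z j) r, ‖z j‖ < ‖c‖ := by
    by_cases h : z j = 0
    · refine ⟨(r / 2 : ℝ), ?_, ?_⟩
      · rw [h, mem_ball_zero_iff, Complex.norm_real, Real.norm_of_nonneg (by positivity)]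
        linarith
      · rw [h, norm_zero, Complex.norm_real, Real.norm_of_nonneg (by positivity)]
        positivity
    · have hz0 := norm_pos_iff.2 h
      refine ⟨((1 + r / (2 * ‖z j‖) : ℝ) : ℂ) * z j, ?_, ?_⟩
      · rw [mem_ball, dist_eq_norm]
        have : ((1 + r / (2 * ‖z j‖) : ℝ) : ℂ) * z j - z j = ((r / (2 * ‖z j‖) : ℝ) : ℂ) * z j := by
          push_cast; ring
        rw [this, norm_mul, Complex.norm_real, Real.norm_of_nonneg (by positivity)]
        field_simp
        linarith
      · rw [norm_mul, Complex.norm_real, Real.norm_of_nonneg (by positivity)]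
        have : 0 < r / (2 * ‖z j‖) := by positivity
        nlinarith
  refine ⟨c, ?_, ?_⟩
  · simpa using hw.trans_lt hcz
  · simpa using hrG hcr

/-! ### Iterated derivatives and coefficients of `𝒜^∞` functions -/

theorem holomorphicOn_iterate_partialDeriv (hG : IsOpen G) (j : Fin n) (m : ℕ)
    (hf : f ∈ holomorphicOn G) : (partialDeriv j)^[m] f ∈ holomorphicOn G := by
  induction m with
  | zero => exact hf
  | succ m ih =>
    rw [Function.iterate_succ_apply']
    exact holomorphicOn_partialDeriv hG j ih

theorem holomorphicOn_foldr_partialDeriv (hG : IsOpen G) (ν : Fin n → ℕ)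
    (hf : f ∈ holomorphicOn G) (l : List (Fin n)) :
    l.foldr (fun j g => (partialDeriv j)^[ν j] g) f ∈ holomorphicOn G := by
  induction l with
  | nil => exact hf
  | cons j l ih => exact holomorphicOn_iterate_partialDeriv hG j _ ih

theorem holomorphicOn_multiDeriv (hG : IsOpen G) (ν : Fin n → ℕ) (hf : f ∈ holomorphicOn G) :
    multiDeriv ν f ∈ holomorphicOn G :=
  holomorphicOn_foldr_partialDeriv hG ν hf _

/-- The bound on `m` keeps the factors `α_j, α_j - 1, …` produced by differentiation nonzero. -/
theorem IsLaurentCoeff.iterate_partialDeriv (hG : IsOpen G) (hc : IsCircled G)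
    (hf : f ∈ holomorphicOn G) {α : Fin n → ℤ} (j : Fin n)
    (ha : ∃ a ≠ 0, IsLaurentCoeff G f α a) (m : ℕ) (hm : m ≤ (α j).toNat) :
    ∃ a ≠ 0, IsLaurentCoeff G ((NCircled.partialDeriv j)^[m] f) (α - Pi.single j (m : ℤ)) a := by
  induction m with
  | zero => simpa using ha
  | succ m ih =>
    obtain ⟨a, ha0, ha⟩ := ih (by omega)
    have h := ha.partialDeriv hG hc (holomorphicOn_iterate_partialDeriv hG j m hf) j
    rw [Function.iterate_succ_apply']
    have hα : α - Pi.single j ((m + 1 : ℕ) : ℤ) = α - Pi.single j (m : ℤ) - Pi.single j 1 := by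
      rw [sub_sub, ← Pi.single_add]
      push_cast
      rfl
    rw [hα]
    refine ⟨_, mul_ne_zero ?_ ha0, h⟩
    simp only [Pi.sub_apply, Pi.single_eq_same]
    norm_cast
    omega

theorem IsLaurentCoeff.foldr_partialDeriv (hG : IsOpen G) (hc : IsCircled G)
    (hf : f ∈ holomorphicOn G) {α : Fin n → ℤ} (ha : ∃ a ≠ 0, IsLaurentCoeff G f α a)
    (l : List (Fin n)) (hl : l.Nodup) :
    ∃ a ≠ 0, IsLaurentCoeff G
      (l.foldr (fun j g => (NCircled.partialDeriv j)^[(α j).toNat] g) f)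
      (fun i => if i ∈ l then min (α i) 0 else α i) a := by
  induction l with
  | nil => simpa using ha
  | cons j l ih =>
    obtain ⟨hj, hl⟩ := List.nodup_cons.1 hl
    have h := IsLaurentCoeff.iterate_partialDeriv hG hc
      (holomorphicOn_foldr_partialDeriv hG (fun j => (α j).toNat) hf l) j (ih hl) (α j).toNat
      (by simp [hj])
    have hα : (fun i => if i ∈ j :: l then min (α i) 0 else α i) =
        (fun i => if i ∈ l then min (α i) 0 else α i) - Pi.single j ((α j).toNat : ℤ) := by
      ext i
      by_cases hij : i = j
      · subst hij
        simp only [List.mem_cons, true_or, if_true, Pi.sub_apply, hj, if_false,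
          Pi.single_eq_same]
        omega
      · simp [hij]
    rw [hα]
    exact h

/-- For a nonzero Laurent coefficient `a_α`, the derivative of order `α⁺` has a nonzero
coefficient at `α ⊓ 0`. -/
theorem IsLaurentCoeff.multiDeriv_toNat (hG : IsOpen G) (hc : IsCircled G)
    (hf : f ∈ holomorphicOn G) {α : Fin n → ℤ} {a : ℂ} (ha0 : a ≠ 0)
    (ha : IsLaurentCoeff G f α a) :
    ∃ b ≠ 0, IsLaurentCoeff G (multiDeriv (fun j => (α j).toNat) f) (fun i => min (α i) 0) b := by
  have h := IsLaurentCoeff.foldr_partialDeriv hG hc hf ⟨a, ha0, ha⟩ (List.finRange n)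
    (List.nodup_finRange n)
  simp only [List.mem_finRange, if_true] at h
  exact h

theorem spaceAInfty_subset : spaceAInfty G ⊆ holomorphicOn G := fun _ hf =>
  (mem_iInter.1 hf 0).1

theorem exists_bound_multiDeriv (hb : Bornology.IsBounded G) (hf : f ∈ spaceAInfty G)
    (ν : Fin n → ℕ) : ∃ C, ∀ z ∈ G, ‖multiDeriv ν f z‖ ≤ C := by
  obtain ⟨g, hg, hgf⟩ := (mem_iInter.1 hf (∑ j, ν j)).2 ν le_rfl
  obtain ⟨C, hC⟩ := hb.isCompact_closure.exists_bound_of_continuousOn hg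
  exact ⟨C, fun z hz => hgf hz ▸ hC z (subset_closure hz)⟩

theorem exists_bound_logNorm (hb : Bornology.IsBounded G) :
    ∃ R, ∀ z ∈ G, ∀ i, logNorm z i ≤ R := by
  obtain ⟨R, hR⟩ := hb.exists_norm_le
  exact ⟨R, fun z hz i => ((Real.log_le_self (norm_nonneg _)).trans (norm_le_pi_norm z i)).trans
    (hR z hz)⟩

/-- Lets estimates proved through logarithms, off the coordinate hyperplanes, pass to the whole
closure. -/
theorem closure_inter_ne_zero (hG : IsOpen G) :
    closure G ⊆ closure (G ∩ {z | ∀ i, z i ≠ 0}) :=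
  closure_minimal (dense_forall_ne_zero.open_subset_closure_inter hG) isClosed_closure

/-- If the closure of `G` meets `{z_j = 0}`, no negative power of `z_j` occurs in the Laurent
expansion of a function of class `𝒜^∞`. -/
theorem IsLaurentCoeff.eq_zero_of_mem_closure (hG : IsOpen G) (hc : IsCircled G)
    (hb : Bornology.IsBounded G) (hf : f ∈ spaceAInfty G) {α : Fin n → ℤ} {a : ℂ}
    (ha : IsLaurentCoeff G f α a) {j : Fin n} (hj : ∃ p ∈ closure G, p j = 0) (hα : α j < 0) :
    a = 0 := by
  by_contra ha0
  obtain ⟨p, hp, hpj⟩ := hj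
  obtain ⟨b, hb0, hb'⟩ := ha.multiDeriv_toNat hG hc (spaceAInfty_subset hf) ha0
  obtain ⟨C, hC⟩ := exists_bound_multiDeriv hb hf fun j => (α j).toNat
  obtain ⟨R, hR⟩ := exists_bound_logNorm hb
  set β : Fin n → ℤ := fun i => min (α i) 0
  have hβ : ∀ i, (β i : ℝ) ≤ 0 := fun i => by exact_mod_cast min_le_right (α i) 0
  have hβj : (β j : ℝ) ≤ -1 := by
    have : β j ≤ -1 := by simp only [β]; omega
    exact_mod_cast this
  -- Since `β ≤ 0`, `β_j ≤ -1` and all logarithms are at most `R`, `|z^β|` is at least a positive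
  -- constant over `|z_j|`. Boundedness of the derivative thus keeps `|z_j|` away from `0`,
  -- contradicting `p j = 0` in the limit.
  have key : ∀ z ∈ G ∩ {z | ∀ i, z i ≠ 0},
      ‖b‖ * Real.exp (∑ i, β i * R + R) ≤ C * ‖z j‖ := by
    rintro z ⟨hz, h0⟩
    have h1 : ‖b‖ * ‖laurentMonomial β z‖ ≤ C := by
      rw [← norm_mul, ← hb' z hz h0]
      exact norm_torusCoeff_le fun t => hC _ (rot_mem hc t hz)
    have h2 : ∑ i, (β i : ℝ) * R + R - logNorm z j ≤ ∑ i, β i * logNorm z i := by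
      have h3 : (β j : ℝ) * (logNorm z j - R) ≤ ∑ i, (β i : ℝ) * (logNorm z i - R) :=
        Finset.single_le_sum (f := fun i => (β i : ℝ) * (logNorm z i - R))
          (fun i _ => mul_nonneg_of_nonpos_of_nonpos (hβ i) (by linarith [hR z hz i]))
          (Finset.mem_univ j)
      simp only [mul_sub, Finset.sum_sub_distrib] at h3
      nlinarith [hR z hz j]
    have hzj : 0 < ‖z j‖ := norm_pos_iff.2 (h0 j)
    rw [norm_laurentMonomial β h0] at h1
    have h4 : Real.exp (∑ i, (β i : ℝ) * R + R) ≤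
        Real.exp (∑ i, β i * logNorm z i) * ‖z j‖ := by
      conv_rhs => rw [← Real.exp_log hzj]
      rw [← Real.exp_add, Real.exp_le_exp]
      simp only [logNorm] at h2 ⊢
      linarith
    calc ‖b‖ * Real.exp (∑ i, β i * R + R)
        ≤ ‖b‖ * (Real.exp (∑ i, β i * logNorm z i) * ‖z j‖) := by gcongr
      _ = (‖b‖ * Real.exp (∑ i, β i * logNorm z i)) * ‖z j‖ := by ring
      _ ≤ C * ‖z j‖ := by gcongr
  have hclosed : IsClosed {z : Fin n → ℂ | ‖b‖ * Real.exp (∑ i, β i * R + R) ≤ C * ‖z j‖} :=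
    isClosed_le continuous_const (by fun_prop)
  have h5 : ‖b‖ * Real.exp (∑ i, β i * R + R) ≤ C * ‖p j‖ :=
    closure_minimal key hclosed (closure_inter_ne_zero hG hp)
  rw [hpj, norm_zero, mul_zero] at h5
  exact absurd h5 (not_le.2 (mul_pos (norm_pos_iff.2 hb0) (Real.exp_pos _)))

/-! ### Coordinatewise completeness and partial hulls -/

/-- Completeness of `G` in the `j`-th coordinate. -/
def IsCompleteIn (G : Set (Fin n → ℂ)) (j : Fin n) : Prop :=
  ∀ z ∈ G, ∀ w : ℂ, ‖w‖ ≤ ‖z j‖ → Function.update z j w ∈ G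

theorem piecewise_mem_of_isCompleteIn (S : Finset (Fin n)) (hS : ∀ j ∈ S, IsCompleteIn G j)
    {z v : Fin n → ℂ} (hz : z ∈ G) (hv : ∀ j ∈ S, ‖v j‖ ≤ ‖z j‖) : S.piecewise v z ∈ G := by
  induction S using Finset.induction_on with
  | empty => simpa
  | insert j S hj ih =>
    rw [Finset.piecewise_insert]
    refine hS j (Finset.mem_insert_self _ _) _
      (ih (fun i hi => hS i (Finset.mem_insert_of_mem hi))
        fun i hi => hv i (Finset.mem_insert_of_mem hi)) _ ?_
    rw [Finset.piecewise_eq_of_notMem _ _ _ hj]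
    exact hv j (Finset.mem_insert_self _ _)

theorem partialHull_subset {ε : Fin n → Fin 2} (h : ∀ j, ε j = 1 → IsCompleteIn G j) :
    partialHull ε G ⊆ G := by
  rintro w ⟨l, hl, z, hz, rfl⟩
  have h1 := piecewise_mem_of_isCompleteIn (Finset.univ.filter fun j => ε j = 1)
    (fun j hj => h j (Finset.mem_filter.1 hj).2) (v := fun j => l j ^ (ε j : ℕ) * z j) hz
    (fun j _ => by
      rw [norm_mul, norm_pow]
      exact mul_le_of_le_one_left (norm_nonneg _) (pow_le_one₀ (norm_nonneg _) (hl j)))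
  convert h1 using 1
  ext j
  by_cases hj : ε j = 1
  · simp [Finset.piecewise, hj]
  · have : ε j = 0 := by omega
    simp [Finset.piecewise, this]

theorem isCompleteIn_of_partialHull_subset {ε : Fin n → Fin 2} (h : partialHull ε G ⊆ G)
    {j : Fin n} (hj : ε j = 1) : IsCompleteIn G j := by
  intro z hz w hw
  -- If `z j = 0` then `w = 0`, and the convention `w / 0 = 0` still gives an admissible multiplier.
  refine h ⟨fun i => if i = j then w / z j else 1, fun i => ?_, z, hz, ?_⟩
  · dsimp only
    split_ifs
    · rw [norm_div]; exact div_le_one_of_le₀ hw (norm_nonneg _)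
    · simp
  · ext i
    by_cases hi : i = j
    · subst hi
      by_cases hz0 : z i = 0
      · have : w = 0 := by simpa [hz0] using hw
        simp [hj, hz0, this]
      · simp [hj, hz0]
    · simp [hi]

/-! ### Integral separation and a noncontinuable function -/

/-- A point outside the closure of a convex set which is bounded above and invariant under
lowering the coordinates in `J` can be separated from it by an integral functional which is
nonnegative in the coordinates in `J`. -/
theorem exists_integral_separation {X : Set (Fin n → ℝ)} (hX : Convex ℝ X) (hne : X.Nonempty)
    {R : ℝ} (hR : ∀ x ∈ X, ∀ i, x i ≤ R) {J : Set (Fin n)}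
    (hJ : ∀ j ∈ J, ∀ x ∈ X, ∀ s : ℝ, 0 ≤ s → x - Pi.single j s ∈ X) {y : Fin n → ℝ}
    (hy : y ∉ closure X) :
    ∃ (α : Fin n → ℤ) (c : ℝ), (∀ j ∈ J, 0 ≤ α j) ∧ (∀ x ∈ X, ∑ i, α i * x i ≤ c) ∧
      c < ∑ i, α i * y i := by
  obtain ⟨φ, u, hφX, hφy⟩ := geometric_hahn_banach_closed_point hX.closure isClosed_closure hy
  set β : Fin n → ℝ := fun i => φ (Pi.single i 1)
  have hφ : ∀ x, φ x = ∑ i, β i * x i := by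
    intro x
    conv_lhs => rw [pi_eq_sum_univ' x]
    rw [map_sum]
    refine Finset.sum_congr rfl fun i _ => ?_
    rw [map_smul, smul_eq_mul, mul_comm]
  obtain ⟨x₀, hx₀⟩ := hne
  have hβ : ∀ j ∈ J, 0 ≤ β j := by
    intro j hj
    by_contra! hneg
    have h0 := hφX _ (subset_closure hx₀)
    -- If `β j < 0`, lowering the `j`-th coordinate by exactly this amount raises `φ` to `u`, which
    -- `φ` never reaches on `X`.
    have h1 := hφX _ (subset_closure (hJ j hj x₀ hx₀ ((u - φ x₀) / (-β j))
      (div_nonneg (by linarith) (by linarith))))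
    have h2 : φ (Pi.single j ((u - φ x₀) / (-β j))) = φ x₀ - u := by
      have h3 : (Pi.single j ((u - φ x₀) / (-β j)) : Fin n → ℝ) =
          ((u - φ x₀) / (-β j)) • Pi.single j (1 : ℝ) := by
        rw [← Pi.single_smul, smul_eq_mul, mul_one]
      rw [h3, map_smul, smul_eq_mul]
      change (u - φ x₀) / (-β j) * β j = _
      have := hneg.ne
      field_simp
      ring
    rw [map_sub, h2] at h1
    linarith
  -- Scaling by `N` widens the gap `φ y - u` beyond the total rounding error: at most `∑ |R|` on `X`
  -- and `∑ |y i|` at `y`.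
  obtain ⟨N, hN⟩ := exists_nat_gt ((∑ _i : Fin n, |R| + ∑ i, |y i|) / (φ y - u))
  rw [div_lt_iff₀ (by linarith)] at hN
  -- Rounding up preserves nonnegativity and makes the error coefficients nonnegative, so the upper
  -- bound `x i ≤ R` alone controls the error on `X`.
  set α : Fin n → ℤ := fun i => ⌈(N : ℝ) * β i⌉
  have hd0 : ∀ i, 0 ≤ (α i : ℝ) - N * β i := fun i => by linarith [Int.le_ceil ((N : ℝ) * β i)]
  have hd1 : ∀ i, (α i : ℝ) - N * β i ≤ 1 := fun i => by
    linarith [Int.ceil_lt_add_one ((N : ℝ) * β i)]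
  have hsplit : ∀ x : Fin n → ℝ, ∑ i, (α i : ℝ) * x i =
      N * φ x + ∑ i, ((α i : ℝ) - N * β i) * x i := by
    intro x
    rw [hφ, Finset.mul_sum, ← Finset.sum_add_distrib]
    exact Finset.sum_congr rfl fun i _ => by ring
  refine ⟨α, N * u + ∑ _i : Fin n, |R|, fun j hj => ?_, fun x hx => ?_, ?_⟩
  · exact Int.ceil_nonneg (mul_nonneg (Nat.cast_nonneg _) (hβ j hj))
  · rw [hsplit]
    refine add_le_add (mul_le_mul_of_nonneg_left (hφX x (subset_closure hx)).le
      (Nat.cast_nonneg _)) (Finset.sum_le_sum fun i _ => ?_)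
    calc ((α i : ℝ) - N * β i) * x i ≤ ((α i : ℝ) - N * β i) * |R| :=
          mul_le_mul_of_nonneg_left ((hR x hx i).trans (le_abs_self R)) (hd0 i)
      _ ≤ 1 * |R| := mul_le_mul_of_nonneg_right (hd1 i) (abs_nonneg _)
      _ = |R| := one_mul _
  · rw [hsplit]
    have h1 : -∑ i, |y i| ≤ ∑ i, ((α i : ℝ) - N * β i) * y i := by
      rw [← Finset.sum_neg_distrib]
      refine Finset.sum_le_sum fun i _ => ?_
      nlinarith [hd0 i, hd1 i, neg_abs_le (y i), abs_nonneg (y i)]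
    nlinarith

/-- Rotation by the arguments of `b`, composed with `expPoint`, maps `logSet G` into `G` and
`logNorm b` to `b`; continuity does the rest. -/
theorem logNorm_notMem_closure_logSet (hc : IsCircled G) {b : Fin n → ℂ} (hb : ∀ i, b i ≠ 0)
    (hbG : b ∉ closure G) : logNorm b ∉ closure (logSet G) := by
  intro h
  apply hbG
  have hcont : Continuous fun x : Fin n → ℝ => fun i =>
      Complex.exp (((b i).arg : ℂ) * Complex.I) * expPoint x i :=
    continuous_pi fun i => continuous_const.mul ((continuous_apply i).comp continuous_expPoint)
  have h1 := map_mem_closure hcont h fun x hx => hc _ hx fun i => (b i).arg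
  convert h1 using 1
  ext i
  rw [expPoint_logNorm_apply hb, mul_comm, Complex.norm_mul_exp_arg_mul_I]

/-- A bounded, fat, logarithmically convex circled domain which is complete in all coordinates
`j` for which its closure meets `{z_j = 0}` is an `𝒜^∞`-domain of holomorphy. -/
theorem isDomainOfHolomorphyFor_spaceAInfty (hG : IsComplexDomain G)
    (hbdd : Bornology.IsBounded G) (hfat : IsFat G) (hc : IsCircled G)
    (hconv : Convex ℝ (logSet G))
    (hJ : ∀ j, (∃ p ∈ closure G, p j = 0) → IsCompleteIn G j) :
    IsDomainOfHolomorphyFor (spaceAInfty G) G := by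
  rintro ⟨G₀, G', hG₀, hG', hsub, hnot, hext⟩
  -- By fatness the open set `G'`, not being inside `G`, is not inside the closure of `G` either.
  obtain ⟨b, ⟨hbG', hbG⟩, hb0⟩ := dense_forall_ne_zero.inter_open_nonempty (G' ∩ (closure G)ᶜ)
    (hG'.1.inter isClosed_closure.isOpen_compl) (by
      by_contra hempty
      refine hnot ?_
      rw [hfat]
      refine interior_maximal (fun z hz => ?_) hG'.1
      by_contra hzG
      exact hempty ⟨z, hz, hzG⟩)
  obtain ⟨R, hR⟩ := exists_bound_logNorm hbdd
  obtain ⟨α, c, hα, hαX, hαb⟩ := exists_integral_separation hconv (logSet_nonempty hG hc)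
    (R := R) (fun x hx i => by simpa [logNorm_expPoint] using hR _ hx i)
    (J := {j | ∃ p ∈ closure G, p j = 0}) (by
      intro j hj x hx s hs
      have h1 := hJ j hj _ hx ((Real.exp (x j - s) : ℝ) : ℂ) (by
        rw [expPoint, Complex.norm_real, Complex.norm_real, Real.norm_of_nonneg (Real.exp_pos _).le,
          Real.norm_of_nonneg (Real.exp_pos _).le, Real.exp_le_exp]
        linarith)
      rw [logSet, mem_preimage]
      convert h1 using 1
      ext i
      by_cases hi : i = j
      · subst hi; simp [expPoint]
      · simp [expPoint, hi])
    (logNorm_notMem_closure_logSet hc hb0 hbG)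
  set m := laurentMonomial α b
  have hreg : ∀ z ∈ closure G, ∀ i, 0 ≤ α i ∨ z i ≠ 0 := fun z hz i => by
    by_cases h : z i = 0
    · exact Or.inl (hα i ⟨z, hz, h⟩)
    · exact Or.inr h
  have hle : ∀ z ∈ closure G, ‖laurentMonomial α z‖ ≤ Real.exp c := by
    intro z hz
    have h1 : ContinuousWithinAt (laurentMonomial α) (G ∩ {z | ∀ i, z i ≠ 0}) z :=
      (differentiableAt_laurentMonomial α (hreg z hz)).continuousAt.continuousWithinAt
    have h2 := h1.mem_closure (t := closedBall 0 (Real.exp c)) (closure_inter_ne_zero hG.1 hz) (by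
      rintro w ⟨hw, hw0⟩
      rw [mem_closedBall_zero_iff, norm_laurentMonomial α hw0, Real.exp_le_exp]
      exact hαX _ ((logNorm_mem_logSet_iff hc hw0).2 hw))
    rwa [isClosed_closedBall.closure_eq, mem_closedBall_zero_iff] at h2
  have hm : Real.exp c < ‖m‖ := by
    rw [norm_laurentMonomial α hb0, Real.exp_lt_exp]
    exact hαb
  have hne : ∀ z ∈ closure G, laurentMonomial α z - m ≠ 0 := by
    intro z hz h
    have := hle z hz
    rw [sub_eq_zero.1 h] at this
    linarith
  -- An open neighbourhood of the closure on which `f` is holomorphic, so all derivatives of `f` are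
  -- continuous up to the boundary.
  set Ω : Set (Fin n → ℂ) := {z | (∀ i, 0 ≤ α i ∨ z i ≠ 0) ∧ laurentMonomial α z - m ≠ 0}
  have hΩ : IsOpen Ω := by
    rw [isOpen_iff_mem_nhds]
    rintro z ⟨hz1, hz2⟩
    have h1 : ∀ i, ∀ᶠ w : Fin n → ℂ in 𝓝 z, 0 ≤ α i ∨ w i ≠ 0 := by
      intro i
      rcases hz1 i with h | h
      · exact Eventually.of_forall fun w => Or.inl h
      · exact ((continuous_apply i).continuousAt.eventually_ne h).mono fun w hw => Or.inr hw
    filter_upwards [eventually_all.2 h1,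
      ((differentiableAt_laurentMonomial α hz1).continuousAt.sub
        continuousAt_const).eventually_ne hz2] with w h1 h2 using ⟨h1, h2⟩
  have hGΩ : closure G ⊆ Ω := fun z hz => ⟨hreg z hz, hne z hz⟩
  set f : (Fin n → ℂ) → ℂ := fun z => (laurentMonomial α z - m)⁻¹
  have hfΩ : f ∈ holomorphicOn Ω := fun z hz =>
    (((differentiableAt_laurentMonomial α hz.1).sub_const m).fun_inv hz.2).differentiableWithinAt
  have hfA : f ∈ spaceAInfty G := by
    refine mem_iInter.2 fun k => ⟨?_, fun ν _ => ⟨multiDeriv ν f, ?_, fun _ _ => rfl⟩⟩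
    · exact DifferentiableOn.mono hfΩ (subset_closure.trans hGΩ)
    · have : DifferentiableOn ℂ (multiDeriv ν f) Ω := holomorphicOn_multiDeriv hΩ ν hfΩ
      exact this.continuousOn.mono hGΩ
  obtain ⟨f', hf', hff'⟩ := hext f hfA
  have hf' : DifferentiableOn ℂ f' G' := hf'
  have hprod : ∀ γ : Fin n → ℕ, Differentiable ℂ fun z : Fin n → ℂ => ∏ i, z i ^ γ i :=
    fun γ z => (HasFDerivAt.finsetProd fun i _ =>
      ((differentiableAt_apply i z).fun_pow _).hasFDerivAt).differentiableAt
  -- With `f = 1/(z^α - m)` cleared of denominators, the relation `f' (z^{α⁺} - m z^{α⁻}) = z^{α⁻}`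
  -- persists on `G'`. At `b` the bracket vanishes but the right side does not.
  have hzero := eqOn_zero_of_isPreconnected hG'.1 hG'.2.isPreconnected
    (f := fun z => f' z * ((∏ i, z i ^ (α i).toNat) - m * ∏ i, z i ^ (-α i).toNat) -
      ∏ i, z i ^ (-α i).toNat)
    ((hf'.mul ((hprod _).sub ((hprod _).const_mul m)).differentiableOn).sub
      (hprod _).differentiableOn) hG₀.1
    (by obtain ⟨z, hz⟩ := hG₀.2.nonempty; exact ⟨z, (hsub hz).2, hz⟩) (by
      intro z hz
      have hzc : z ∈ closure G := subset_closure (hsub hz).1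
      rw [hff' hz, ← laurentMonomial_neg_part_mul α (hreg z hzc)]
      have := hne z hzc
      simp only [f]
      field_simp
      ring) b hbG'
  simp only [← laurentMonomial_neg_part_mul α fun i => Or.inr (hb0 i)] at hzero
  have hP : ∏ i, b i ^ (-α i).toNat ≠ 0 := Finset.prod_ne_zero_iff.2 fun i _ => pow_ne_zero _ (hb0 i)
  apply hP
  linear_combination -hzero

end NCircled

/-! ### The equivalence -/

open NCircled

theorem corollary6 (n : ℕ) (G : Set (Fin n → ℂ))
    (hdom : NCircled.IsComplexDomain G)
    (hbdd : Bornology.IsBounded G)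
    (hfat : NCircled.IsFat G)
    (hcirc : NCircled.IsCircled G)
    (hhol : NCircled.IsDomainOfHolomorphy G) :
    NCircled.IsDomainOfHolomorphyFor (NCircled.spaceAInfty G) G ↔
      ∀ ε : Fin n → Fin 2, (NCircled.stratum ε ∩ frontier G).Nonempty →
        NCircled.partialHull ε G ⊆ G := by
  constructor
  · rintro hA ε ⟨p, ⟨hp1, -⟩, hp⟩
    refine partialHull_subset fun j hj z hz w hw => ?_
    exact update_mem_of_coeff_eq_zero spaceAInfty_subset hdom hcirc hfat hA
      (fun f hf α a ha hα => ha.eq_zero_of_mem_closure hdom.1 hcirc hbdd hf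
        ⟨p, frontier_subset_closure hp, hp1 j hj⟩ hα) hz hw
  · intro h
    refine isDomainOfHolomorphyFor_spaceAInfty hdom hbdd hfat hcirc
      (convex_logSet subset_rfl hdom hcirc hhol) ?_
    rintro j ⟨p, hp, hpj⟩
    -- If the hyperplane meets `G`, no function in `𝒪(G)` has negative powers of `z_j`. Otherwise
    -- `p` is a boundary point, and the hypothesis applies with `ε` recording the zero coordinates
    -- of `p`.
    by_cases hpG : p ∈ G
    · intro z hz w hw
      exact update_mem_of_coeff_eq_zero subset_rfl hdom hcirc hfat hhol
        (fun f hf α a ha hα => ha.eq_zero_of_mem hdom hcirc hf ⟨p, hpG, hpj⟩ hα) hz hw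
    · refine isCompleteIn_of_partialHull_subset
        (ε := fun i => if p i = 0 then 1 else 0) (h _ ⟨p, ⟨?_, ?_⟩, ?_⟩) (by simp [hpj])
      · intro i hi
        by_contra hne
        simp [hne] at hi
      · intro i hi hne
        simp [hne] at hi
      · rw [hdom.1.frontier_eq]
        exact ⟨hp, hpG⟩
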